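/- Let $K$ be an algebraically closed field and $Q$ a finite quiver without oriented cycles, so that the path algebra $KQ$ is a finite-dimensional hereditary algebra. Let $KQ\text{-mod}$ be the category of finitely generated left $KQ$-modules; subcategories are full and closed under isomorphism. A torsion pair is a pair $(\mathcal T,\mathcal F)$ of subcategories such that $\operatorname{Hom}(X,Y)=0$ for all $X\in\mathcal T$, $Y\in\mathcal F$, and every $X\in KQ\text{-mod}$ has an exact sequence $0\to X_{\mathcal T}\to X\to X_{\mathcal F}\to 0$ with $X_{\mathcal T}\in\mathcal T$, $X_{\mathcal F}\in\mathcal F$. Let $\mathcal P(Q)$ and $\mathcal I(Q)$ be the subcategories of projective and of injective modules in $KQ\text{-mod}$, let $\tau=D\operatorname{Tr}$ and $\tau^-=\operatorname{Tr}D$ be the Auslander–Reiten translates, let $\tau\mathcal C$ (resp. $\tau^-\mathcal C$) be the subcategory of modules isomorphic to $\tau X$ (resp. $\tau^-X$) with $X\in\mathcal C$, and let $\mathcal C\oplus\mathcal D$ be the subcategory of modules isomorphic to $Y\oplus Z$ with $Y\in\mathcal C$, $Z\in\mathcal D$. Let $\mathbf F_1(Q)$ be the set of torsion pairs $(\mathcal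 T,\mathcal F)$ with $\mathcal I(Q)\subseteq\mathcal T$, and $\mathbf F_2(Q)$ the set of those with $\mathcal P(Q)\subseteq\mathcal F$. Proposition 5.3. Suppose that no nonzero $KQ$-module in $KQ\text{-mod}$ is both projective and injective. Then $$\sigma^-(\mathcal T,\mathcal F)=(\tau^-\mathcal T,\ \tau^-\mathcal F\oplus\mathcal P(Q)),\qquad \sigma(\mathcal T,\mathcal F)=(\mathcal I(Q)\oplus\tau\mathcal T,\ \tau\mathcal F)$$ define mutually inverse bijections $\sigma^-:\mathbf F_1(Q)\to\mathbf F_2(Q)$ and $\sigma:\mathbf F_2(Q)\to\mathbf F_1(Q)$. -/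

import Mathlib

open CategoryTheory

universe uK u v w

noncomputable section

/-! ### The path algebra of a quiver -/

/-- All paths of a quiver: triples (source, target, path from the source to the target). -/
abbrev QuiverPath (V : Type u) [Quiver.{v} V] : Type (max u v) :=
  Σ (a : V) (b : V), Quiver.Path a b

/-- The quiver has no oriented cycles: every path from a vertex to itself is trivial. -/
def QuiverAcyclic (V : Type u) [Quiver.{v} V] : Prop :=
  ∀ (a : V) (p : Quiver.Path a a), p = Quiver.Path.nil

/-- The path algebra `KQ`: the vector space with basis the paths of `Q`. -/
def PathAlgebra (K : Type uK) (V : Type u) [Field K] [Quiver.{v} V] : Type (max uK u v) :=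
  QuiverPath V →₀ K

namespace PathAlgebra

variable (K : Type uK) (V : Type u) [Field K] [Quiver.{v} V]

instance : AddCommGroup (PathAlgebra K V) := inferInstanceAs (AddCommGroup (QuiverPath V →₀ K))

instance : Module K (PathAlgebra K V) := inferInstanceAs (Module K (QuiverPath V →₀ K))

variable {V}

/-- The basis element given by a path. -/
def ofPath {a b : V} (p : Quiver.Path a b) : PathAlgebra K V :=
  Finsupp.single (⟨a, b, p⟩ : QuiverPath V) (1 : K)

open Classical in
/-- The product `q * p` of two paths is the concatenation "first `p`, then `q`" if `p` ends where
`q` starts, and `0` otherwise; so left modules are the covariant representations of the quiver. -/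
def pathMul (q p : QuiverPath V) : PathAlgebra K V :=
  if h : p.2.1 = q.1 then ofPath K (p.2.2.comp (q.2.2.cast h.symm rfl)) else 0

variable (V)

/-- The multiplication of the path algebra, extended bilinearly from paths. -/
def mulMap : PathAlgebra K V →ₗ[K] PathAlgebra K V →ₗ[K] PathAlgebra K V :=
  Finsupp.linearCombination K fun q : QuiverPath V =>
    (Finsupp.linearCombination K fun p : QuiverPath V => pathMul K q p :
      (QuiverPath V →₀ K) →ₗ[K] PathAlgebra K V)

instance : Mul (PathAlgebra K V) := ⟨fun x y => mulMap K V x y⟩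

variable {V}

lemma ofPath_mul (q p : QuiverPath V) :
    ofPath K q.2.2 * ofPath K p.2.2 = pathMul K q p := by
  have h1 : mulMap K V (ofPath K q.2.2) =
      (Finsupp.linearCombination K fun p : QuiverPath V => pathMul K q p) :=
    (Finsupp.linearCombination_single K (1 : K) q).trans (one_smul K _)
  change mulMap K V (ofPath K q.2.2) (ofPath K p.2.2) = _
  rw [h1]
  exact (Finsupp.linearCombination_single K (1 : K) p).trans (one_smul K _)

lemma ofPath_mul_ofPath {a b c : V} (p : Quiver.Path a b) (q : Quiver.Path b c) :
    ofPath K q * ofPath K p = ofPath K (p.comp q) := by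
  rw [ofPath_mul K ⟨b, c, q⟩ ⟨a, b, p⟩]
  simp [pathMul]

lemma ofPath_mul_of_ne {a b c d : V} (p : Quiver.Path a b) (q : Quiver.Path c d) (h : b ≠ c) :
    ofPath K q * ofPath K p = 0 := by
  rw [ofPath_mul K ⟨c, d, q⟩ ⟨a, b, p⟩]
  simp [pathMul, h]

/-- Linear maps out of the path algebra are determined by their values on paths. -/
lemma hom_ext {N : Type*} [AddCommGroup N] [Module K N] {f g : PathAlgebra K V →ₗ[K] N}
    (h : ∀ (a b : V) (p : Quiver.Path a b), f (ofPath K p) = g (ofPath K p)) : f = g := by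
  refine Finsupp.lhom_ext' fun x => LinearMap.ext_ring ?_
  exact h x.1 x.2.1 x.2.2

variable (V)

lemma mulMap_assoc (x y z : PathAlgebra K V) :
    mulMap K V (mulMap K V x y) z = mulMap K V x (mulMap K V y z) := by
  have h1 : (LinearMap.compr₂ (mulMap K V) (mulMap K V)) =
      (LinearMap.lcomp K _ (mulMap K V)).comp
        ((LinearMap.llcomp K _ _ _).comp (mulMap K V)) := by
    refine hom_ext K fun c d r => hom_ext K fun b b' q => hom_ext K fun a a' p => ?_
    change (ofPath K r * ofPath K q) * ofPath K p = ofPath K r * (ofPath K q * ofPath K p)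
    by_cases h : b' = c
    · subst h
      by_cases h' : a' = b
      · subst h'
        simp [ofPath_mul_ofPath]
      · rw [ofPath_mul_ofPath, ofPath_mul_of_ne K p _ h', ofPath_mul_of_ne K p _ h']
        exact (map_zero (mulMap K V (ofPath K r))).symm
    · rw [ofPath_mul_of_ne K q r h]
      have hz : (0 : PathAlgebra K V) * ofPath K p = 0 := by
        change mulMap K V 0 _ = 0
        simp
      rw [hz]
      by_cases h' : a' = b
      · subst h'
        rw [ofPath_mul_ofPath, ofPath_mul_of_ne K _ r h]
      · rw [ofPath_mul_of_ne K p q h']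
        exact (map_zero (mulMap K V (ofPath K r))).symm
  exact LinearMap.congr_fun (LinearMap.congr_fun (LinearMap.congr_fun h1 x) y) z

variable [Fintype V]

/-- The unit of the path algebra is the sum of the trivial paths. -/
instance : One (PathAlgebra K V) := ⟨∑ a : V, ofPath K (Quiver.Path.nil : Quiver.Path a a)⟩

lemma one_def :
    (1 : PathAlgebra K V) = ∑ a : V, ofPath K (Quiver.Path.nil : Quiver.Path a a) := rfl

lemma mulMap_one_left : mulMap K V 1 = LinearMap.id := by
  refine hom_ext K fun a b p => ?_
  rw [one_def, map_sum, LinearMap.sum_apply, Finset.sum_eq_single b]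
  · exact ofPath_mul_ofPath K p Quiver.Path.nil
  · exact fun c _ hc => ofPath_mul_of_ne K p _ hc.symm
  · simp

lemma mulMap_one_right : (mulMap K V).flip 1 = LinearMap.id := by
  refine hom_ext K fun a b p => ?_
  rw [one_def, map_sum, LinearMap.sum_apply, Finset.sum_eq_single a]
  · exact (ofPath_mul_ofPath K (Quiver.Path.nil : Quiver.Path a a) p).trans (by simp)
  · exact fun c _ hc => ofPath_mul_of_ne K _ p hc
  · simp

instance : Ring (PathAlgebra K V) :=
  { (inferInstance : AddCommGroup (PathAlgebra K V)) with
    mul := (· * ·)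
    one := 1
    left_distrib := fun x y z => map_add (mulMap K V x) y z
    right_distrib := fun x y z => LinearMap.map_add₂ (mulMap K V) x y z
    zero_mul := fun x => LinearMap.map_zero₂ (mulMap K V) x
    mul_zero := fun x => map_zero (mulMap K V x)
    mul_assoc := mulMap_assoc K V
    one_mul := fun x => LinearMap.congr_fun (mulMap_one_left K V) x
    mul_one := fun x => LinearMap.congr_fun (mulMap_one_right K V) x }

instance : Algebra K (PathAlgebra K V) :=
  Algebra.ofModule (fun r x y => LinearMap.map_smul₂ (mulMap K V) r x y)
    (fun r x y => map_smul (mulMap K V x) r y)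

end PathAlgebra

/-! ### The Auslander–Reiten translates -/

/-- A submodule `N` of `M` is superfluous if `N + L = M` only for `L = M`. -/
def IsSuperfluous {R : Type*} {M : Type*} [Ring R] [AddCommGroup M] [Module R M]
    (N : Submodule R M) : Prop :=
  ∀ L : Submodule R M, N ⊔ L = ⊤ → L = ⊤

/-- `P₁ → P₀ → M → 0` is a minimal projective presentation: `P₀ → M` and `P₁ → ker (P₀ → M)` are
projective covers by finitely generated modules. -/
structure IsMinimalPresentation {R P₁ P₀ M : Type*} [Ring R]
    [AddCommGroup P₁] [Module R P₁] [AddCommGroup P₀] [Module R P₀] [AddCommGroup M] [Module R M]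
    (f : P₁ →ₗ[R] P₀) (g : P₀ →ₗ[R] M) : Prop where
  finite_one : Module.Finite R P₁
  finite_zero : Module.Finite R P₀
  projective_one : Module.Projective R P₁
  projective_zero : Module.Projective R P₀
  surjective : Function.Surjective g
  exact : Function.Exact f g
  superfluous_zero : IsSuperfluous (LinearMap.ker g)
  superfluous_one : IsSuperfluous (LinearMap.ker f)

/-- The cokernel of `Hom_R(P₀, B) → Hom_R(P₁, B)`, for a bimodule `B` over `R` and `S`, as an
`S`-module. For a minimal projective presentation `P₁ → P₀ → M → 0` and `B` the regular bimodule
of an algebra, this is the transpose `Tr M`. -/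
abbrev TransposeOf {R : Type*} (S B : Type*) {P₁ P₀ : Type*} [Ring R] [Ring S]
    [AddCommGroup B] [Module R B] [Module S B] [SMulCommClass R S B]
    [AddCommGroup P₁] [Module R P₁] [AddCommGroup P₀] [Module R P₀] (f : P₁ →ₗ[R] P₀) : Type _ :=
  (P₁ →ₗ[R] B) ⧸ LinearMap.range (LinearMap.lcomp S B f : (P₀ →ₗ[R] B) →ₗ[S] (P₁ →ₗ[R] B))

section Duality

variable (K : Type*) (A : Type*) [Field K] [Ring A] [Algebra K A]

/-- The `K`-dual `D M = Hom_K(M, K)` of a left `A`-module `M`, which is a right `A`-module. -/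
def DualOfLeft (M : Type*) [AddCommGroup M] [Module A M] : Type _ :=
  RestrictScalars K A M →ₗ[K] K

/-- The `K`-dual `D N = Hom_K(N, K)` of a right `A`-module `N`, which is a left `A`-module. -/
def DualOfRight (N : Type*) [AddCommGroup N] [Module Aᵐᵒᵖ N] : Type _ :=
  RestrictScalars K Aᵐᵒᵖ N →ₗ[K] K

section

variable (M : Type*) [AddCommGroup M] [Module A M]

instance : AddCommGroup (DualOfLeft K A M) :=
  inferInstanceAs (AddCommGroup (RestrictScalars K A M →ₗ[K] K))

/-- The right action `(f a)(m) = f (a m)`. -/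
instance : Module Aᵐᵒᵖ (DualOfLeft K A M) where
  smul a f := LinearMap.comp (M₂ := RestrictScalars K A M) f
    (RestrictScalars.lsmul K A M a.unop)
  one_smul f := LinearMap.ext fun m => by
    change f.toFun (RestrictScalars.lsmul K A M 1 m) = f.toFun m
    rw [map_one]; rfl
  mul_smul a b f := LinearMap.ext fun m => by
    change f.toFun (RestrictScalars.lsmul K A M (b.unop * a.unop) m) =
      f.toFun (RestrictScalars.lsmul K A M b.unop (RestrictScalars.lsmul K A M a.unop m))
    rw [map_mul]; rfl
  smul_zero a := LinearMap.ext fun m => rfl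
  smul_add a f g := LinearMap.ext fun m => rfl
  add_smul a b f := LinearMap.ext fun m => by
    change f.toFun (RestrictScalars.lsmul K A M (a.unop + b.unop) m) =
      f.toFun (RestrictScalars.lsmul K A M a.unop m) +
        f.toFun (RestrictScalars.lsmul K A M b.unop m)
    rw [map_add]; exact LinearMap.map_add (show RestrictScalars K A M →ₗ[K] K from f) _ _
  zero_smul f := LinearMap.ext fun m => by
    change f.toFun (RestrictScalars.lsmul K A M 0 m) = 0
    rw [map_zero]; exact LinearMap.map_zero (show RestrictScalars K A M →ₗ[K] K from f)

end

section

variable (N : Type*) [AddCommGroup N] [Module Aᵐᵒᵖ N]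

instance : AddCommGroup (DualOfRight K A N) :=
  inferInstanceAs (AddCommGroup (RestrictScalars K Aᵐᵒᵖ N →ₗ[K] K))

/-- The left action `(a f)(n) = f (n a)`. -/
instance : Module A (DualOfRight K A N) where
  smul a f := LinearMap.comp (M₂ := RestrictScalars K Aᵐᵒᵖ N) f
    (RestrictScalars.lsmul K Aᵐᵒᵖ N (MulOpposite.op a))
  one_smul f := LinearMap.ext fun n => by
    change f.toFun (RestrictScalars.lsmul K Aᵐᵒᵖ N 1 n) = f.toFun n
    rw [map_one]; rfl
  mul_smul a b f := LinearMap.ext fun n => by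
    change f.toFun (RestrictScalars.lsmul K Aᵐᵒᵖ N (MulOpposite.op b * MulOpposite.op a) n) =
      f.toFun (RestrictScalars.lsmul K Aᵐᵒᵖ N (MulOpposite.op b)
        (RestrictScalars.lsmul K Aᵐᵒᵖ N (MulOpposite.op a) n))
    rw [map_mul]; rfl
  smul_zero a := LinearMap.ext fun n => rfl
  smul_add a f g := LinearMap.ext fun n => rfl
  add_smul a b f := LinearMap.ext fun n => by
    change f.toFun (RestrictScalars.lsmul K Aᵐᵒᵖ N (MulOpposite.op a + MulOpposite.op b) n) =
      f.toFun (RestrictScalars.lsmul K Aᵐᵒᵖ N (MulOpposite.op a) n) +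
        f.toFun (RestrictScalars.lsmul K Aᵐᵒᵖ N (MulOpposite.op b) n)
    rw [map_add]; exact LinearMap.map_add (show RestrictScalars K Aᵐᵒᵖ N →ₗ[K] K from f) _ _
  zero_smul f := LinearMap.ext fun n => by
    change f.toFun (RestrictScalars.lsmul K Aᵐᵒᵖ N 0 n) = 0
    rw [map_zero]; exact LinearMap.map_zero (show RestrictScalars K Aᵐᵒᵖ N →ₗ[K] K from f)

end

end Duality

section Translates

variable (K : Type uK) (A : Type w) [Field K] [Ring A] [Algebra K A]

/-- `Y ≅ τ X = D Tr X`. The module `Tr X` is computed from any minimal projective presentation of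
the left module `X`; as usual, `τ X` is a module determined up to isomorphism. -/
def IsARTranslate (X Y : FGModuleCat.{w} A) : Prop :=
  ∃ (P₁ P₀ : FGModuleCat.{w} A) (f : P₁ →ₗ[A] P₀) (g : P₀ →ₗ[A] X),
    IsMinimalPresentation f g ∧ Nonempty (Y ≃ₗ[A] DualOfRight K A (TransposeOf Aᵐᵒᵖ A f))

/-- `Y ≅ τ⁻ X = Tr D X`. The module `Tr D X` is computed from any minimal projective presentation
of the right module `D X`. -/
def IsInverseARTranslate (X Y : FGModuleCat.{w} A) : Prop :=
  ∃ (P₁ P₀ : FGModuleCat.{w} Aᵐᵒᵖ) (f : P₁ →ₗ[Aᵐᵒᵖ] P₀) (g : P₀ →ₗ[Aᵐᵒᵖ] DualOfLeft K A X),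
    IsMinimalPresentation f g ∧ Nonempty (Y ≃ₗ[A] TransposeOf A A f)

end Translates

/-! ### Torsion pairs and their translation

A full subcategory of `A`-mod is given by the property of its objects. -/

section TorsionPairs

variable (K : Type uK) (A : Type w) [Field K] [Ring A] [Algebra K A]

variable {A} in
/-- A pair of full subcategories (closed under isomorphism) of `A`-mod is a torsion pair. -/
structure IsTorsionPair (p : ObjectProperty (FGModuleCat.{w} A) × ObjectProperty (FGModuleCat.{w} A)) :
    Prop where
  iso_closed_fst : p.1.IsClosedUnderIsomorphisms
  iso_closed_snd : p.2.IsClosedUnderIsomorphisms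
  hom_eq_zero : ∀ X Y : FGModuleCat.{w} A, p.1 X → p.2 Y → ∀ f : X →ₗ[A] Y, f = 0
  exists_exact : ∀ X : FGModuleCat.{w} A, ∃ (T F : FGModuleCat.{w} A) (i : T →ₗ[A] X)
    (q : X →ₗ[A] F), p.1 T ∧ p.2 F ∧ Function.Injective i ∧ Function.Exact i q ∧
      Function.Surjective q

/-- The finitely generated projective `A`-modules. -/
def projectiveModules : ObjectProperty (FGModuleCat.{w} A) := fun X => Module.Projective A X

/-- The finitely generated injective `A`-modules. -/
def injectiveModules : ObjectProperty (FGModuleCat.{w} A) := fun X => Module.Injective A X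

variable {A} in
/-- `𝒞 ⊕ 𝒟`: the modules isomorphic to `Y ⊕ Z` with `Y` in `𝒞` and `Z` in `𝒟`. -/
def sumSubcategory (𝒞 𝒟 : ObjectProperty (FGModuleCat.{w} A)) :
    ObjectProperty (FGModuleCat.{w} A) :=
  fun X => ∃ Y Z : FGModuleCat.{w} A, 𝒞 Y ∧ 𝒟 Z ∧ Nonempty (X ≃ₗ[A] (Y × Z))

variable {A}

/-- `τ 𝒞`: the modules isomorphic to `τ X` with `X` in `𝒞`. -/
def arTranslate (𝒞 : ObjectProperty (FGModuleCat.{w} A)) : ObjectProperty (FGModuleCat.{w} A) :=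
  fun Y => ∃ X, 𝒞 X ∧ IsARTranslate K A X Y

/-- `τ⁻ 𝒞`: the modules isomorphic to `τ⁻ X` with `X` in `𝒞`. -/
def inverseARTranslate (𝒞 : ObjectProperty (FGModuleCat.{w} A)) :
    ObjectProperty (FGModuleCat.{w} A) :=
  fun Y => ∃ X, 𝒞 X ∧ IsInverseARTranslate K A X Y

/-- `σ⁻ (𝒯, ℱ) = (τ⁻ 𝒯, τ⁻ ℱ ⊕ 𝒫)`. -/
def torsionSigmaInv (p : ObjectProperty (FGModuleCat.{w} A) × ObjectProperty (FGModuleCat.{w} A)) :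
    ObjectProperty (FGModuleCat.{w} A) × ObjectProperty (FGModuleCat.{w} A) :=
  (inverseARTranslate K p.1, sumSubcategory (inverseARTranslate K p.2) (projectiveModules A))

/-- `σ (𝒯, ℱ) = (ℐ ⊕ τ 𝒯, τ ℱ)`. -/
def torsionSigma (p : ObjectProperty (FGModuleCat.{w} A) × ObjectProperty (FGModuleCat.{w} A)) :
    ObjectProperty (FGModuleCat.{w} A) × ObjectProperty (FGModuleCat.{w} A) :=
  (sumSubcategory (injectiveModules A) (arTranslate K p.1), arTranslate K p.2)

variable (A)

/-- `𝐅₁`: the torsion pairs whose torsion class contains all injective modules. -/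
def torsionPairsOne :
    Set (ObjectProperty (FGModuleCat.{w} A) × ObjectProperty (FGModuleCat.{w} A)) :=
  {p | IsTorsionPair p ∧ injectiveModules A ≤ p.1}

/-- `𝐅₂`: the torsion pairs whose torsion-free class contains all projective modules. -/
def torsionPairsTwo :
    Set (ObjectProperty (FGModuleCat.{w} A) × ObjectProperty (FGModuleCat.{w} A)) :=
  {p | IsTorsionPair p ∧ projectiveModules A ≤ p.2}

end TorsionPairs

end

noncomputable section

/-! Write `A` for the path algebra and `D` for the duality over `K`. Since `τ = D Tr` and `τ⁻ = Tr
D`, both maps factor through torsion pairs over `Aᵐᵒᵖ` (`torsionSigma_eq`, `torsionSigmaInv_eq`).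
The duality sends `(𝒯, ℱ)` to `(D ℱ, D 𝒯)` and exchanges injectives with projectives, so it matches
`𝐅₁` on one side with `𝐅₂` on the other and is undone by the opposite duality. What remains is that
`(𝒯, ℱ) ↦ (Tr ℱ, Tr 𝒯 ⊕ 𝒫)` maps `𝐅₂` over `A` to `𝐅₂` over `Aᵐᵒᵖ` and is inverted by the same
construction on the other side (`transposePair_mem`, `transposePair_transposePair`).

Heredity gives `X` a resolution `0 → P₁ → P₀ → X → 0`, so that `Tr X`, the cokernel of `P₀* → P₁*`,
is `Ext¹(X, A)`. As `P** ≅ P`, four facts follow: `Tr X` has no nonzero map to a projective; `Tr Tr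
X ≅ X` if `Hom(X, A) = 0`; `Hom(X, Y) = 0` forces `Hom(Tr Y, Tr X) = 0`; and a short exact sequence
whose left term has no nonzero map to `A` is turned into a short exact sequence. For a pair in `𝐅₂`
every torsion module has no nonzero map to `A`, because `A` is torsion-free. Every other module is
such a module plus a projective summand, which `Tr` does not see.

The arguments are carried out for a bimodule `B` over `R` and `S`, symmetrically in the two rings,
so that they serve left and right modules alike.

The path algebra is hereditary because a simple module `S_a` at a vertex has a projective first
syzygy, and every finite-dimensional module is built from such simples by extensions. -/

/-- Submodules of finitely generated projective modules are projective. -/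
def IsFGHereditary (R : Type w) [Ring R] : Prop :=
  ∀ (P : Type w) [AddCommGroup P] [Module R P] [Module.Finite R P] [Module.Projective R P]
    (N : Submodule R P), Module.Projective R N

/-- In `0 → N → P → P ⧸ N → 0` with `P` projective, the projective dimension of `N` is one less than
the bound for `P ⧸ N`. -/
lemma isFGHereditary_of_hasProjectiveDimensionLT {R : Type w} [Ring R]
    (h : ∀ (M : Type w) [AddCommGroup M] [Module R M] [Module.Finite R M],
      HasProjectiveDimensionLT (ModuleCat.of R M) 2) : IsFGHereditary R := by
  intro P _ _ _ _ N
  have hS := N.mkQ.shortExact_shortComplexKer N.mkQ_surjective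
  have : Projective (ModuleCat.of R P) := (IsProjective.iff_projective P).1 inferInstance
  have h1 := (hS.hasProjectiveDimensionLT_X₃_iff 0 this).1 (h (P ⧸ N))
  have h2 : Projective (ModuleCat.of R (LinearMap.ker N.mkQ)) :=
    projective_iff_hasProjectiveDimensionLT_one.2 h1
  have h3 := (IsProjective.iff_projective (LinearMap.ker N.mkQ)).2 h2
  rwa [Submodule.ker_mkQ] at h3

/-! ### Finiteness of the set of paths of an acyclic quiver -/

section Quiver

variable {V : Type u} [Quiver.{v} V]

/-- There is a path of positive length from `a` to `b`. -/
def QuiverBefore (a b : V) : Prop := ∃ p : Quiver.Path a b, 0 < p.length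

instance : IsTrans V QuiverBefore :=
  ⟨fun _ _ _ ⟨p, hp⟩ ⟨q, _⟩ => ⟨p.comp q, by rw [Quiver.Path.length_comp]; omega⟩⟩

lemma QuiverAcyclic.irrefl (hV : QuiverAcyclic V) : Std.Irrefl (QuiverBefore (V := V)) :=
  ⟨fun a ⟨p, hp⟩ => by rw [hV a p] at hp; simp at hp⟩

lemma QuiverAcyclic.wellFounded [Finite V] (hV : QuiverAcyclic V) :
    WellFounded (QuiverBefore (V := V)) :=
  haveI := hV.irrefl
  Finite.wellFounded_of_trans_of_irrefl _

lemma QuiverAcyclic.wellFounded_swap [Finite V] (hV : QuiverAcyclic V) :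
    WellFounded (Function.swap (QuiverBefore (V := V))) :=
  haveI := hV.irrefl
  Finite.wellFounded_of_trans_of_irrefl _

lemma QuiverAcyclic.finite_path [Finite V] [∀ a b : V, Finite (a ⟶ b)] (hV : QuiverAcyclic V)
    (a c : V) : Finite (Quiver.Path a c) := by
  induction c using hV.wellFounded.induction with
  | _ c ih =>
    have hfin (x : Σ b : V, (b ⟶ c)) : Finite (Quiver.Path a x.1) :=
      ih x.1 ⟨x.2.toPath, by simp⟩
    -- Paths into `c` are sorted by their last arrow; `none` collects the trivial ones.
    let g : Option (Σ x : (Σ b : V, (b ⟶ c)), Quiver.Path a x.1) → Set (Quiver.Path a c) :=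
      fun o => o.elim {p | p.length = 0} fun y => {y.2.cons y.1.2}
    have hg : (⋃ o, g o) = Set.univ := by
      refine Set.eq_univ_of_forall fun p => Set.mem_iUnion.2 ?_
      cases p with
      | nil => exact ⟨none, rfl⟩
      | cons p α => exact ⟨some ⟨⟨_, α⟩, p⟩, rfl⟩
    rw [← Set.finite_univ_iff, ← hg]
    refine Set.finite_iUnion fun o => ?_
    cases o with
    | none =>
      refine Set.Subsingleton.finite fun p hp q hq => ?_
      have hac := Quiver.Path.eq_of_length_zero p hp
      subst hac
      rw [hV a p, hV a q]
    | some y => exact Set.finite_singleton _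

lemma QuiverAcyclic.finite_quiverPath [Finite V] [∀ a b : V, Finite (a ⟶ b)]
    (hV : QuiverAcyclic V) : Finite (QuiverPath V) :=
  haveI := hV.finite_path
  inferInstance

end Quiver

/-! ### The path algebra of an acyclic quiver is hereditary -/

namespace PathAlgebra

variable (K : Type uK) {V : Type u} [Field K] [Quiver.{v} V]

lemma finite [Finite V] [∀ a b : V, Finite (a ⟶ b)] (hV : QuiverAcyclic V) :
    Module.Finite K (PathAlgebra K V) :=
  haveI := hV.finite_quiverPath
  inferInstanceAs (Module.Finite K (QuiverPath V →₀ K))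

/-- The idempotent of a vertex. -/
abbrev idem (a : V) : PathAlgebra K V := ofPath K (Quiver.Path.nil : Quiver.Path a a)

/-- The coefficient of the trivial path at `a`. -/
def idemCoeff (a : V) : PathAlgebra K V →ₗ[K] K :=
  Finsupp.lapply (⟨a, a, Quiver.Path.nil⟩ : QuiverPath V)

variable {K}

lemma mem_span_of_idemCoeff_eq_zero {a : V} {x : PathAlgebra K V} (hx : idemCoeff K a x = 0) :
    x ∈ Submodule.span K {y : PathAlgebra K V | ∃ p : QuiverPath V,
      p ≠ ⟨a, a, Quiver.Path.nil⟩ ∧ y = ofPath K p.2.2} := by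
  have h1 : Membership.mem (γ := Submodule K (QuiverPath V →₀ K))
      (Finsupp.supported K K {p : QuiverPath V | p ≠ ⟨a, a, Quiver.Path.nil⟩}) x := by
    refine (Finsupp.mem_supported' K (M := K) x).2 fun p hp => ?_
    rw [Set.mem_ofPred_eq, not_not] at hp
    rw [hp]
    exact hx
  rw [Finsupp.supported_eq_span_single] at h1
  refine Submodule.span_mono ?_ h1
  rintro _ ⟨p, hp, rfl⟩
  exact ⟨p, hp, rfl⟩

lemma idemCoeff_ofPath_of_ne {a : V} {p : QuiverPath V} (hp : p ≠ ⟨a, a, Quiver.Path.nil⟩) :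
    idemCoeff K a (ofPath K p.2.2) = 0 :=
  Finsupp.single_eq_of_ne hp.symm

lemma idemCoeff_idem (a : V) : idemCoeff K a (idem K a) = 1 :=
  Finsupp.single_eq_same

variable [Fintype V]

section Lift

variable {E : Type*} [AddCommGroup E] [Module (PathAlgebra K V) E]

open Classical in
/-- A map on paths, compatible with left multiplication away from the trivial path at `a`. -/
def pathLift (a : V) (s : QuiverPath V → E) (b : V) : ∀ {c : V}, Quiver.Path b c → E
  -- The idempotent factor puts the value into `e_c E` for the end vertex `c`, so that paths not
  -- starting at `c` kill it, as they kill the path itself.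
  | _, .nil => idem K b • s ⟨b, b, .nil⟩
  | c, .cons (b := d) p α =>
    if (⟨b, d, p⟩ : QuiverPath V) = ⟨a, a, .nil⟩ then idem K c • s ⟨b, c, p.cons α⟩
    else ofPath K α.toPath • pathLift a s b p

lemma idem_smul_pathLift (a : V) (s : QuiverPath V → E) {b c : V} (p : Quiver.Path b c) :
    idem K c • pathLift (K := K) a s b p = pathLift (K := K) a s b p := by
  cases p with
  | nil => simp only [pathLift]; rw [← mul_smul, ofPath_mul_ofPath]; rfl
  | cons p α =>
    simp only [pathLift]
    split_ifs
    · rw [← mul_smul, ofPath_mul_ofPath]; rfl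
    · rw [← mul_smul, ofPath_mul_ofPath]; rfl

/-- The exceptional branch of the recursion occurs only when the path before the last arrow is the
trivial path at `a`. An extension of a path other than that one never meets it, so each further
arrow just multiplies. -/
lemma pathLift_comp (a : V) (s : QuiverPath V → E) {b c d : V} (p : Quiver.Path b c)
    (hp : (⟨b, c, p⟩ : QuiverPath V) ≠ ⟨a, a, .nil⟩) (q : Quiver.Path c d) :
    pathLift (K := K) a s b (p.comp q) = ofPath K q • pathLift (K := K) a s b p := by
  induction q with
  | nil => exact (idem_smul_pathLift a s p).symm
  | cons q α ih =>
    have hne : (⟨b, _, p.comp q⟩ : QuiverPath V) ≠ ⟨a, a, .nil⟩ := by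
      intro h
      cases q with
      | nil => exact hp h
      | cons q β =>
        have := congrArg (fun x : QuiverPath V => x.2.2.length) h
        simp at this
    rw [Quiver.Path.comp_cons]
    simp only [pathLift]
    rw [if_neg hne, ih, ← mul_smul, ofPath_mul_ofPath]
    rfl

end Lift

/-- Such an `L` is spanned by all paths except the trivial one at `a`, hence is the direct sum of
the `KQ e_b` with `b ≠ a` and the `KQ α` with `α` an arrow starting at `a`; each is projective.
Accordingly a section of `π` is obtained by choosing preimages of these generators and spreading
them along paths with `pathLift`. -/
lemma projective_of_mem_iff_idemCoeff (a : V)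
    (L : Submodule (PathAlgebra K V) (PathAlgebra K V)) (hL : ∀ x, x ∈ L ↔ idemCoeff K a x = 0) :
    Module.Projective (PathAlgebra K V) L := by
  classical
  refine Module.Projective.of_lifting_property'' fun π hπ => ?_
  -- The default `0` is used only for the trivial path at `a`, the one path outside `L`.
  let s : QuiverPath V → (L →₀ PathAlgebra K V) := fun p =>
    if h : ofPath K p.2.2 ∈ L then (hπ ⟨_, h⟩).choose else 0
  have hs (p : QuiverPath V) (h : ofPath K p.2.2 ∈ L) : π (s p) = ⟨_, h⟩ := by
    simp only [s, dif_pos h]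
    exact (hπ ⟨_, h⟩).choose_spec
  have hmem (p : QuiverPath V) (hp : p ≠ ⟨a, a, .nil⟩) : ofPath K p.2.2 ∈ L :=
    (hL _).2 (idemCoeff_ofPath_of_ne hp)
  let ψ : PathAlgebra K V →ₗ[K] (L →₀ PathAlgebra K V) :=
    Finsupp.linearCombination K fun p : QuiverPath V => pathLift (K := K) a s p.1 p.2.2
  have hψ (p : QuiverPath V) : ψ (ofPath K p.2.2) = pathLift (K := K) a s p.1 p.2.2 :=
    (Finsupp.linearCombination_single K (1 : K) p).trans (one_smul K _)
  have hπψ (b c : V) (p : Quiver.Path b c) (hp : (⟨b, c, p⟩ : QuiverPath V) ≠ ⟨a, a, .nil⟩) :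
      (π (pathLift (K := K) a s b p) : PathAlgebra K V) = ofPath K p := by
    induction p with
    | nil =>
      simp only [pathLift]
      rw [map_smul, hs _ (hmem _ hp)]
      exact ofPath_mul_ofPath K _ _
    | cons p α ih =>
      simp only [pathLift]
      split_ifs with h
      · rw [map_smul, hs _ (hmem _ hp)]
        exact ofPath_mul_ofPath K _ _
      · rw [map_smul, Submodule.coe_smul, ih h]
        exact ofPath_mul_ofPath K _ _
  -- Linearity fails at the trivial path at `a`, since arrows leaving `a` received independent
  -- values; it is claimed only on `L`.
  have hlin (r x : PathAlgebra K V) (hx : x ∈ L) : ψ (r * x) = r • ψ x := by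
    have hx' := mem_span_of_idemCoeff_eq_zero ((hL x).1 hx)
    clear hx
    induction hx' using Submodule.span_induction with
    | mem x hx =>
      obtain ⟨⟨b, c, p⟩, hp, rfl⟩ := hx
      have key : ψ ∘ₗ LinearMap.mulRight K (ofPath K p) =
          (LinearMap.toSpanSingleton (PathAlgebra K V) _ (ψ (ofPath K p))).restrictScalars K := by
        refine hom_ext K fun d e q => ?_
        change ψ (ofPath K q * ofPath K p) = ofPath K q • ψ (ofPath K p)
        by_cases h : c = d
        · subst h
          rw [ofPath_mul_ofPath, hψ ⟨b, e, p.comp q⟩, hψ ⟨b, c, p⟩]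
          exact pathLift_comp a s p hp q
        · rw [ofPath_mul_of_ne K p q h, hψ ⟨b, c, p⟩]
          dsimp only
          rw [← idem_smul_pathLift a s p, ← mul_smul, ofPath_mul_of_ne K _ q h, zero_smul, map_zero]
      exact LinearMap.congr_fun key r
    | zero => simp
    | add x y hx hy h1 h2 => rw [mul_add, map_add, map_add, h1, h2, smul_add]
    | smul k x hx h =>
      rw [mul_smul_comm, map_smul, map_smul, h, smul_algebra_smul_comm]
  refine ⟨{ toFun := fun x => ψ x, map_add' := fun x y => by simp,
            map_smul' := fun r x => hlin r x x.2 }, LinearMap.ext fun x => Subtype.ext ?_⟩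
  have key (y : PathAlgebra K V) (hy : idemCoeff K a y = 0) :
      (π (ψ y) : PathAlgebra K V) = y := by
    have hy' := mem_span_of_idemCoeff_eq_zero hy
    clear hy
    induction hy' using Submodule.span_induction with
    | mem y hy =>
      obtain ⟨⟨b, c, p⟩, hp, rfl⟩ := hy
      rw [hψ ⟨b, c, p⟩]
      exact hπψ b c p hp
    | zero => simp
    | add x y hx hy h1 h2 => rw [map_add, map_add, Submodule.coe_add, h1, h2]
    | smul k y hy h =>
      rw [map_smul, LinearMap.map_smul_of_tower]
      exact congrArg (k • ·) h
  exact key x ((hL x).1 x.2)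

section Hereditary

variable {M : Type*} [AddCommGroup M] [Module (PathAlgebra K V) M] [Module K M]
  [IsScalarTower K (PathAlgebra K V) M]

/-- Every nonzero module over the path algebra of an acyclic quiver contains a nonzero vector
on which the algebra acts through the coefficient of a trivial path. -/
lemma exists_smul_eq_idemCoeff_smul (hV : QuiverAcyclic V) [Nontrivial M] :
    ∃ (a : V) (m : M), m ≠ 0 ∧ ∀ x : PathAlgebra K V, x • m = idemCoeff K a x • m := by
  have hne : {a : V | ∃ m : M, idem K a • m ≠ 0}.Nonempty := by
    obtain ⟨m, hm⟩ := exists_ne (0 : M)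
    by_contra! h
    refine hm ?_
    rw [← one_smul (PathAlgebra K V) m, one_def, Finset.sum_smul]
    refine Finset.sum_eq_zero fun a _ => ?_
    by_contra hc
    exact Set.notMem_empty a (h ▸ (⟨m, hc⟩ : ∃ m : M, idem K a • m ≠ 0))
  -- The vertex `a` is a sink of the support of `M`: no path of positive length leads from `a` to a
  -- vertex `c` with `e_c M ≠ 0`. Hence all nontrivial paths annihilate `e_a m`.
  obtain ⟨a, ⟨m, hm⟩, hmin⟩ := hV.wellFounded_swap.has_min _ hne
  refine ⟨a, idem K a • m, hm, fun x => ?_⟩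
  have key : (LinearMap.toSpanSingleton (PathAlgebra K V) M (idem K a • m)).restrictScalars K =
      LinearMap.toSpanSingleton K M (idem K a • m) ∘ₗ idemCoeff K a := by
    refine hom_ext K fun b c p => ?_
    change ofPath K p • idem K a • m = idemCoeff K a (ofPath K p) • idem K a • m
    by_cases hp : (⟨b, c, p⟩ : QuiverPath V) = ⟨a, a, .nil⟩
    · cases hp
      rw [← mul_smul, ofPath_mul_ofPath, idemCoeff_idem, one_smul]
      rfl
    · rw [idemCoeff_ofPath_of_ne (p := ⟨b, c, p⟩) hp, zero_smul]
      by_cases hab : b = a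
      · subst hab
        have hlen : 0 < p.length := by
          cases p with
          | nil => exact absurd rfl hp
          | cons p α => simp
        by_contra hc
        refine hmin c ⟨ofPath K p • idem K b • m, ?_⟩ ⟨p, hlen⟩
        rw [← mul_smul, ofPath_mul_ofPath]
        exact hc
      · rw [← mul_smul, ofPath_mul_of_ne K _ p (Ne.symm hab), zero_smul]
  exact LinearMap.congr_fun key x

end Hereditary

/-- Induction on the dimension: `m` spans a simple submodule `N`, which is `KQ` modulo the
projective ideal of elements with zero coefficient at a trivial path, and `M ⧸ N` is smaller. The
bound passes to extensions. -/
lemma hasProjectiveDimensionLT_two [∀ a b : V, Finite (a ⟶ b)] (hV : QuiverAcyclic V) (n : ℕ) :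
    ∀ (M : Type (max uK u v)) [AddCommGroup M] [Module (PathAlgebra K V) M] [Module K M]
      [IsScalarTower K (PathAlgebra K V) M] [Module.Finite K M], Module.finrank K M = n →
      HasProjectiveDimensionLT (ModuleCat.of (PathAlgebra K V) M) 2 := by
  induction n using Nat.strong_induction_on with
  | _ n ih =>
  intro M _ _ _ _ _ hn
  rcases subsingleton_or_nontrivial M with hM | hM
  · have : Projective (ModuleCat.of (PathAlgebra K V) M) :=
      (IsProjective.iff_projective M).1 inferInstance
    infer_instance
  obtain ⟨a, m, hm, hx⟩ := exists_smul_eq_idemCoeff_smul (K := K) (M := M) hV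
  let N : Submodule (PathAlgebra K V) M := LinearMap.range
    (LinearMap.toSpanSingleton (PathAlgebra K V) M m)
  have hmN : m ∈ N := ⟨1, one_smul _ m⟩
  let φ : PathAlgebra K V →ₗ[PathAlgebra K V] N :=
    (LinearMap.toSpanSingleton (PathAlgebra K V) M m).rangeRestrict
  have hφ : Function.Surjective φ := LinearMap.surjective_rangeRestrict _
  have hker : Module.Projective (PathAlgebra K V) (LinearMap.ker φ) := by
    refine projective_of_mem_iff_idemCoeff a _ fun x => ?_
    rw [LinearMap.ker_rangeRestrict, LinearMap.mem_ker, LinearMap.toSpanSingleton_apply, hx x]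
    simp [hm]
  have hN : HasProjectiveDimensionLT (ModuleCat.of (PathAlgebra K V) N) 2 := by
    have : Projective (ModuleCat.of (PathAlgebra K V) (PathAlgebra K V)) :=
      (IsProjective.iff_projective _).1 inferInstance
    exact (φ.shortExact_shortComplexKer hφ |>.hasProjectiveDimensionLT_X₃_iff 0 this).2
      (projective_iff_hasProjectiveDimensionLT_one.1 ((IsProjective.iff_projective _).1 hker))
  have hQ : HasProjectiveDimensionLT (ModuleCat.of (PathAlgebra K V) (M ⧸ N)) 2 := by
    have hfr := (N.restrictScalars K).finrank_quotient_add_finrank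
    have hpos : 0 < Module.finrank K (N.restrictScalars K) :=
      have : Nontrivial (N.restrictScalars K) := ⟨⟨m, hmN⟩, 0, fun h => hm congr($h.1)⟩
      Module.finrank_pos
    have e : ((M ⧸ N) ≃ₗ[K] (M ⧸ N.restrictScalars K)) :=
      (Submodule.Quotient.restrictScalarsEquiv K N).symm
    have : Module.Finite K (M ⧸ N) := Module.Finite.equiv e.symm
    refine ih (Module.finrank K (M ⧸ N)) ?_ (M ⧸ N) rfl
    rw [e.finrank_eq]
    omega
  have hS := N.mkQ.shortExact_shortComplexKer N.mkQ_surjective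
  refine hS.hasProjectiveDimensionLT_X₂ 2 ?_ hQ
  change HasProjectiveDimensionLT (ModuleCat.of _ (LinearMap.ker N.mkQ)) 2
  rwa [Submodule.ker_mkQ]

lemma isFGHereditary [∀ a b : V, Finite (a ⟶ b)] (hV : QuiverAcyclic V) :
    IsFGHereditary (PathAlgebra K V) := by
  refine isFGHereditary_of_hasProjectiveDimensionLT fun M _ _ _ => ?_
  let : Module K M := Module.compHom M (algebraMap K (PathAlgebra K V))
  have : IsScalarTower K (PathAlgebra K V) M := IsScalarTower.of_algebraMap_smul fun _ _ => rfl
  have := PathAlgebra.finite K hV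
  have : Module.Finite K M := Module.Finite.trans (PathAlgebra K V) M
  exact hasProjectiveDimensionLT_two hV _ M rfl

end PathAlgebra

/-! ### Resolutions of length one and minimal presentations -/

section Resolutions

variable {R P₁ P₀ M : Type*} [Ring R]
    [AddCommGroup P₁] [Module R P₁] [AddCommGroup P₀] [Module R P₀] [AddCommGroup M] [Module R M]

/-- `0 → P₁ → P₀ → M → 0` is a resolution by finitely generated projective modules. -/
structure IsProjResolution (f : P₁ →ₗ[R] P₀) (g : P₀ →ₗ[R] M) : Prop where
  finite_one : Module.Finite R P₁
  finite_zero : Module.Finite R P₀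
  projective_one : Module.Projective R P₁
  projective_zero : Module.Projective R P₀
  injective : Function.Injective f
  exact : Function.Exact f g
  surjective : Function.Surjective g

lemma LinearMap.exists_lift_of_range_le {P E C : Type*} [AddCommGroup P] [Module R P]
    [AddCommGroup E] [Module R E] [AddCommGroup C] [Module R C] [Module.Projective R P]
    (f : E →ₗ[R] C) (φ : P →ₗ[R] C) (h : ∀ x, φ x ∈ LinearMap.range f) :
    ∃ ψ : P →ₗ[R] E, f ∘ₗ ψ = φ := by
  obtain ⟨ψ, hψ⟩ := Module.projective_lifting_property f.rangeRestrict
    (φ.codRestrict (LinearMap.range f) h) f.surjective_rangeRestrict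
  exact ⟨ψ, LinearMap.ext fun x => congr($(LinearMap.congr_fun hψ x).1)⟩

/-- A map out of `P₀` killing the kernel of a surjection `g : P₀ → M` factors through `g`. -/
lemma LinearMap.exists_factor_of_ker_le {N : Type*} [AddCommGroup N] [Module R N]
    {g : P₀ →ₗ[R] M} (hg : Function.Surjective g) (φ : P₀ →ₗ[R] N)
    (h : LinearMap.ker g ≤ LinearMap.ker φ) : ∃ ψ : M →ₗ[R] N, ψ ∘ₗ g = φ := by
  refine ⟨(LinearMap.ker g).liftQ φ h ∘ₗ (g.quotKerEquivOfSurjective hg).symm, ?_⟩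
  ext x
  have : (g.quotKerEquivOfSurjective hg).symm (g x) = (LinearMap.ker g).mkQ x := by
    rw [LinearEquiv.symm_apply_eq]
    rfl
  simp [this]

namespace IsProjResolution

variable {Q₁ Q₀ N : Type*} [AddCommGroup Q₁] [Module R Q₁] [AddCommGroup Q₀] [Module R Q₀]
  [AddCommGroup N] [Module R N] {f : P₁ →ₗ[R] P₀} {g : P₀ →ₗ[R] M} {f' : Q₁ →ₗ[R] Q₀}
  {g' : Q₀ →ₗ[R] N}

lemma exists_chainMap (h : IsProjResolution f g) (h' : IsProjResolution f' g') (φ : M →ₗ[R] N) :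
    ∃ (u₁ : P₁ →ₗ[R] Q₁) (u₀ : P₀ →ₗ[R] Q₀), g' ∘ₗ u₀ = φ ∘ₗ g ∧ f' ∘ₗ u₁ = u₀ ∘ₗ f := by
  have := h.projective_one
  have := h.projective_zero
  obtain ⟨u₀, hu₀⟩ := Module.projective_lifting_property g' (φ ∘ₗ g) h'.surjective
  obtain ⟨u₁, hu₁⟩ := f'.exists_lift_of_range_le (u₀ ∘ₗ f) fun x => by
    refine (h'.exact _).1 ?_
    have := LinearMap.congr_fun hu₀ (f x)
    simpa [h.exact.apply_apply_eq_zero x] using this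
  exact ⟨u₁, u₀, hu₀, hu₁⟩

/-- The map `u₀` lands in the kernel of `g'`, which is the image of `f'`, so it lifts to `s`;
injectivity of `f'` then identifies `s ∘ f` with `u₁`. -/
lemma exists_homotopy (h : IsProjResolution f g) (h' : IsProjResolution f' g')
    {u₁ : P₁ →ₗ[R] Q₁} {u₀ : P₀ →ₗ[R] Q₀} (hu : f' ∘ₗ u₁ = u₀ ∘ₗ f) (hu₀ : g' ∘ₗ u₀ = 0) :
    ∃ s : P₀ →ₗ[R] Q₁, u₁ = s ∘ₗ f := by
  have := h.projective_zero
  obtain ⟨s, hs⟩ := f'.exists_lift_of_range_le u₀ fun x =>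
    (h'.exact _).1 (LinearMap.congr_fun hu₀ x)
  refine ⟨s, LinearMap.ext fun x => h'.injective ?_⟩
  have h1 := LinearMap.congr_fun hu x
  have h2 := LinearMap.congr_fun hs (f x)
  simp only [LinearMap.comp_apply] at h1 h2 ⊢
  rw [h1, h2]

lemma congr_right (h : IsProjResolution f g) (e : M ≃ₗ[R] N) :
    IsProjResolution f (e.toLinearMap ∘ₗ g) :=
  { h with
    exact := fun x => by
      simpa using h.exact x
    surjective := e.surjective.comp h.surjective }

lemma prod (h : IsProjResolution f g) [Module.Finite R N] [Module.Projective R N] :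
    IsProjResolution (LinearMap.inl R P₀ N ∘ₗ f) (g.prodMap (LinearMap.id : N →ₗ[R] N)) where
  finite_one := h.finite_one
  finite_zero := have := h.finite_zero; inferInstance
  projective_one := h.projective_one
  projective_zero := have := h.projective_zero; inferInstance
  injective := LinearMap.inl_injective.comp h.injective
  exact := fun x => by
    rcases x with ⟨x, y⟩
    simp only [LinearMap.prodMap_apply, LinearMap.id_apply, Prod.mk_eq_zero, h.exact x,
      Set.mem_range, LinearMap.comp_apply, LinearMap.inl_apply, Prod.mk.injEq]
    constructor
    · rintro ⟨⟨z, hz⟩, rfl⟩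
      exact ⟨z, hz, rfl⟩
    · rintro ⟨z, hz, rfl⟩
      exact ⟨⟨z, hz⟩, rfl⟩
  surjective := Function.Surjective.prodMap h.surjective Function.surjective_id

end IsProjResolution

/-- The surjection onto the range splits. Its kernel and the image of the section `s` span `P₁`, so
superfluity makes `s` surjective, and the kernel vanishes. -/
lemma LinearMap.injective_of_isSuperfluous_ker_of_projective_range [Module.Projective R P₀]
    {f : P₁ →ₗ[R] P₀} (hf : IsSuperfluous (LinearMap.ker f))
    (h : Module.Projective R (LinearMap.range f)) : Function.Injective f := by
  obtain ⟨s, hs⟩ := Module.projective_lifting_property f.rangeRestrict LinearMap.id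
    f.surjective_rangeRestrict
  have htop : LinearMap.range s = ⊤ := by
    refine hf _ (eq_top_iff.2 fun x _ => ?_)
    rw [show x = (x - s (f.rangeRestrict x)) + s (f.rangeRestrict x) by abel]
    refine Submodule.add_mem_sup ?_ ⟨_, rfl⟩
    have := LinearMap.congr_fun hs (f.rangeRestrict x)
    rw [LinearMap.mem_ker, map_sub, sub_eq_zero]
    exact congr($this.1).symm
  refine (injective_iff_map_eq_zero f).2 fun x hx => ?_
  obtain ⟨y, rfl⟩ := LinearMap.range_eq_top.1 htop x
  have := LinearMap.congr_fun hs y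
  have h0 : f.rangeRestrict (s y) = 0 := Subtype.ext hx
  rw [LinearMap.comp_apply, h0] at this
  rw [show y = 0 from this.symm, map_zero]

end Resolutions

lemma IsMinimalPresentation.isProjResolution {R P₀ : Type w} {P₁ M : Type*} [Ring R]
    [AddCommGroup P₁] [Module R P₁] [AddCommGroup P₀] [Module R P₀] [AddCommGroup M] [Module R M]
    (hR : IsFGHereditary R) {f : P₁ →ₗ[R] P₀} {g : P₀ →ₗ[R] M} (h : IsMinimalPresentation f g) :
    IsProjResolution f g where
  finite_one := h.finite_one
  finite_zero := h.finite_zero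
  projective_one := h.projective_one
  projective_zero := h.projective_zero
  injective :=
    have := h.finite_zero
    have := h.projective_zero
    LinearMap.injective_of_isSuperfluous_ker_of_projective_range h.superfluous_one (hR P₀ _)
  exact := h.exact
  surjective := h.surjective

lemma exists_isMinimalPresentation {R M : Type w} [Ring R] [IsArtinianRing R]
    [AddCommGroup M] [Module R M] [Module.Finite R M] (hR : IsFGHereditary R) :
    ∃ (P₁ P₀ : FGModuleCat.{w} R) (f : P₁ →ₗ[R] P₀) (g : P₀ →ₗ[R] M),
      IsMinimalPresentation f g := by
  obtain ⟨n, g, hg⟩ := Module.Finite.exists_fin' R M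
  -- The projective cover is a minimal submodule of `Rⁿ` still mapping onto `M`. Heredity makes it
  -- projective, and minimality makes the kernel superfluous.
  obtain ⟨Q, hQ, hmin⟩ := IsArtinian.set_has_minimal
    {Q : Submodule R (Fin n → R) | Submodule.map g Q = ⊤} ⟨⊤, by
      simpa using LinearMap.range_eq_top.2 hg⟩
  have hproj := hR (Fin n → R) Q
  let g' : Q →ₗ[R] M := g ∘ₗ Q.subtype
  have hg' : Function.Surjective g' := by
    intro y
    obtain ⟨x, hx, rfl⟩ : y ∈ Submodule.map g Q := by rw [hQ]; trivial
    exact ⟨⟨x, hx⟩, rfl⟩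
  have hsup : IsSuperfluous (LinearMap.ker g') := by
    intro L hL
    have hLQ : Submodule.map Q.subtype L ≤ Q := Submodule.map_subtype_le Q L
    have hmem : Submodule.map g (Submodule.map Q.subtype L) = ⊤ := by
      rw [← Submodule.map_comp, eq_top_iff]
      rintro y -
      obtain ⟨x, rfl⟩ := hg' y
      obtain ⟨k, hk, l, hl, rfl⟩ := Submodule.mem_sup.1 (hL ▸ Submodule.mem_top : x ∈ _)
      refine ⟨l, hl, ?_⟩
      rw [map_add, LinearMap.mem_ker.1 hk, zero_add]
    have heq : Submodule.map Q.subtype L = Q := hLQ.eq_of_not_lt (hmin _ hmem)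
    refine eq_top_iff.2 fun x _ => ?_
    obtain ⟨y, hy, hyx⟩ := heq.ge x.2
    rwa [← Subtype.ext hyx]
  have hproj' := hR Q (LinearMap.ker g')
  refine ⟨FGModuleCat.of R (LinearMap.ker g'), FGModuleCat.of R Q, (LinearMap.ker g').subtype, g',
    inferInstance, inferInstance, hproj', hproj, hg', fun x => by simp, hsup, fun L hL => ?_⟩
  rwa [Submodule.ker_subtype, bot_sup_eq] at hL

/-! ### Duality of projectives over the two sides of a bimodule -/

/-- The bimodule `B` is finitely generated projective on both sides, and each ring is the
endomorphism ring of `B` over the other one. -/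
structure IsDualizingBimodule (R S B : Type*) [Ring R] [Ring S] [AddCommGroup B] [Module R B]
    [Module S B] : Prop where
  finite_left : Module.Finite R B
  finite_right : Module.Finite S B
  projective_left : Module.Projective R B
  projective_right : Module.Projective S B
  existsUnique_left : ∀ φ : B →ₗ[S] B, ∃! r : R, ∀ b, φ b = r • b
  existsUnique_right : ∀ φ : B →ₗ[R] B, ∃! s : S, ∀ b, φ b = s • b

section Bimodule

variable {R S B : Type*} [Ring R] [Ring S] [AddCommGroup B] [Module R B] [Module S B]
  [SMulCommClass R S B] [SMulCommClass S R B]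

namespace IsDualizingBimodule

omit [SMulCommClass R S B] [SMulCommClass S R B] in
lemma symm (h : IsDualizingBimodule R S B) : IsDualizingBimodule S R B :=
  ⟨h.finite_right, h.finite_left, h.projective_right, h.projective_left, h.existsUnique_right,
    h.existsUnique_left⟩

omit [SMulCommClass R S B] [SMulCommClass S R B] in
lemma eq_zero_of_smul_eq_zero (h : IsDualizingBimodule R S B) {r : R} (hr : ∀ b : B, r • b = 0) :
    r = 0 :=
  (h.existsUnique_left 0).unique (fun b => (hr b).symm) (fun b => (zero_smul R b).symm)

end IsDualizingBimodule

variable (R S B) in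
/-- The evaluation map into the double dual. -/
def dualEval (P : Type*) [AddCommGroup P] [Module R P] : P →ₗ[R] ((P →ₗ[R] B) →ₗ[S] B) where
  toFun x := { toFun := fun φ => φ x, map_add' := fun _ _ => rfl, map_smul' := fun _ _ => rfl }
  map_add' x y := LinearMap.ext fun φ => map_add φ x y
  map_smul' r x := LinearMap.ext fun φ => map_smul φ r x

variable {P Q : Type*} [AddCommGroup P] [Module R P] [AddCommGroup Q] [Module R Q]

/-- A coordinate function followed by the orbit map of an element of `B`. -/
def coordSMul (S : Type*) [Ring S] [Module S B] [SMulCommClass R S B] [SMulCommClass S R B]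
    (c : P →ₗ[R] R) : B →ₗ[S] (P →ₗ[R] B) where
  toFun b := LinearMap.toSpanSingleton R B b ∘ₗ c
  map_add' _ _ := LinearMap.ext fun _ => smul_add _ _ _
  map_smul' _ _ := LinearMap.ext fun _ => smul_comm _ _ _

lemma coordSMul_apply (c : P →ₗ[R] R) (b : B) (x : P) : coordSMul S c b x = c x • b := rfl

lemma exists_dual_basis (R P : Type*) [Ring R] [AddCommGroup P] [Module R P] [Module.Finite R P]
    [Module.Projective R P] :
    ∃ (n : ℕ) (x : Fin n → P) (c : Fin n → P →ₗ[R] R), ∀ y, ∑ i, c i y • x i = y := by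
  obtain ⟨n, f, g, -, -, hfg⟩ := Module.Finite.exists_comp_eq_id_of_projective R P
  refine ⟨n, fun i => f (Pi.single i 1), fun i => LinearMap.proj i ∘ₗ g, fun y => ?_⟩
  conv_rhs => rw [← LinearMap.id_apply (R := R) y, ← hfg, LinearMap.comp_apply,
    ← Finset.univ_sum_single (g y), map_sum]
  refine Finset.sum_congr rfl fun i _ => ?_
  rw [← map_smul, ← Pi.single_smul', smul_eq_mul, mul_one]
  rfl

namespace IsDualizingBimodule

variable (h : IsDualizingBimodule R S B) [Module.Finite R P] [Module.Projective R P]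
include h

lemma dualEval_injective : Function.Injective (dualEval R S B P) := by
  refine (injective_iff_map_eq_zero _).2 fun y hy => ?_
  obtain ⟨n, x, c, hxc⟩ := exists_dual_basis R P
  have hc (i) : c i y = 0 :=
    h.eq_zero_of_smul_eq_zero fun b => LinearMap.congr_fun hy (coordSMul S (c i) b)
  rw [← hxc y]
  simp [hc]

/-- Restricted to the copy of `B` belonging to the coordinate `c i`, the functional `Φ` is an
`S`-endomorphism of `B`, hence multiplication by some `r i`; then `∑ r i • x i` represents `Φ`. -/
lemma dualEval_surjective : Function.Surjective (dualEval R S B P) := by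
  intro Φ
  obtain ⟨n, x, c, hxc⟩ := exists_dual_basis R P
  choose r hr _ using fun i => h.existsUnique_left (Φ ∘ₗ coordSMul S (c i))
  refine ⟨∑ i, r i • x i, LinearMap.ext fun φ => ?_⟩
  have hφ : φ = ∑ i, coordSMul S (c i) (φ (x i)) := by
    ext y
    conv_lhs => rw [← hxc y]
    simp [coordSMul_apply]
  calc φ (∑ i, r i • x i) = ∑ i, r i • φ (x i) := by simp
    _ = ∑ i, Φ (coordSMul S (c i) (φ (x i))) := Finset.sum_congr rfl fun i _ => (hr i _).symm
    _ = Φ φ := by rw [← map_sum, ← hφ]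

lemma dualEval_bijective : Function.Bijective (dualEval R S B P) :=
  ⟨h.dualEval_injective, h.dualEval_surjective⟩

omit h in
lemma _root_.exists_retraction_dual :
    ∃ (n : ℕ) (p : (Fin n → B) →ₗ[S] (P →ₗ[R] B)) (q : (P →ₗ[R] B) →ₗ[S] (Fin n → B)),
      p ∘ₗ q = LinearMap.id := by
  obtain ⟨n, x, c, hxc⟩ := exists_dual_basis R P
  refine ⟨n, ∑ i, coordSMul S (c i) ∘ₗ LinearMap.proj i,
    LinearMap.pi fun i => dualEval R S B P (x i), LinearMap.ext fun φ => LinearMap.ext fun y => ?_⟩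
  conv_rhs => rw [← hxc y]
  simp [coordSMul_apply, dualEval]

lemma finite_dual : Module.Finite S (P →ₗ[R] B) := by
  obtain ⟨n, p, q, hpq⟩ := exists_retraction_dual (R := R) (S := S) (B := B) (P := P)
  have := h.finite_right
  exact Module.Finite.of_surjective p fun φ => ⟨q φ, LinearMap.congr_fun hpq φ⟩

lemma projective_dual : Module.Projective S (P →ₗ[R] B) := by
  obtain ⟨n, p, q, hpq⟩ := exists_retraction_dual (R := R) (S := S) (B := B) (P := P)
  have := h.projective_right
  have : Module.Projective S (Fin n → B) :=
    Module.Projective.of_equiv (DFinsupp.linearEquivFunOnFintype (R := S) (M := fun _ : Fin n => B))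
  exact Module.Projective.of_split q p hpq

lemma lcomp_injective {u v : Q →ₗ[R] P} (huv : LinearMap.lcomp S B u = LinearMap.lcomp S B v) :
    u = v :=
  LinearMap.ext fun x => h.dualEval_injective <| LinearMap.ext fun φ =>
    LinearMap.congr_fun (LinearMap.congr_fun huv φ) x

/-- Dualizing is full: transpose `t` once more and conjugate by the evaluation maps. Only the one
for `P` has to be inverted. -/
lemma exists_lcomp_eq (t : (P →ₗ[R] B) →ₗ[S] (Q →ₗ[R] B)) :
    ∃ u : Q →ₗ[R] P, LinearMap.lcomp S B u = t := by
  let e := LinearEquiv.ofBijective (dualEval R S B P) h.dualEval_bijective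
  refine ⟨e.symm.toLinearMap ∘ₗ LinearMap.lcomp R B t ∘ₗ dualEval R S B Q, ?_⟩
  ext φ x
  have := LinearMap.congr_fun (e.apply_symm_apply ((LinearMap.lcomp R B t) (dualEval R S B Q x))) φ
  exact this

end IsDualizingBimodule

/-! ### The transpose -/

variable {P₁ P₀ X Q₁ Q₀ Y : Type*} [AddCommGroup P₁] [Module R P₁] [AddCommGroup P₀] [Module R P₀]
  [AddCommGroup X] [Module R X] [AddCommGroup Q₁] [Module R Q₁] [AddCommGroup Q₀] [Module R Q₀]
  [AddCommGroup Y] [Module R Y]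
  {f : P₁ →ₗ[R] P₀} {g : P₀ →ₗ[R] X} {f' : Q₁ →ₗ[R] Q₀} {g' : Q₀ →ₗ[R] Y}

omit [SMulCommClass S R B] in
lemma mkQ_lcomp (y : P₀ →ₗ[R] B) :
    (LinearMap.range (LinearMap.lcomp S B f)).mkQ (LinearMap.lcomp S B f y) = 0 :=
  (Submodule.Quotient.mk_eq_zero _).2 (LinearMap.mem_range_self _ y)

/-- The map of transposes induced by a map of presentations. -/
def transposeMap (S B : Type*) [Ring S] [AddCommGroup B] [Module R B] [Module S B]
    [SMulCommClass R S B] (u₁ : P₁ →ₗ[R] Q₁) (u₀ : P₀ →ₗ[R] Q₀)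
    (hu : f' ∘ₗ u₁ = u₀ ∘ₗ f) : TransposeOf S B f' →ₗ[S] TransposeOf S B f :=
  Submodule.mapQ _ _ (LinearMap.lcomp S B u₁) <| by
    rintro _ ⟨y, rfl⟩
    exact ⟨LinearMap.lcomp S B u₀ y, LinearMap.ext fun x =>
      congrArg y (LinearMap.congr_fun hu x).symm⟩

omit [SMulCommClass S R B] in
lemma transposeMap_comp_transposeMap_eq_id (h : IsProjResolution f g) {u₁ : P₁ →ₗ[R] Q₁}
    {u₀ : P₀ →ₗ[R] Q₀} (hu : f' ∘ₗ u₁ = u₀ ∘ₗ f) {v₁ : Q₁ →ₗ[R] P₁} {v₀ : Q₀ →ₗ[R] P₀}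
    (hv : f ∘ₗ v₁ = v₀ ∘ₗ f') (hvu : g ∘ₗ v₀ ∘ₗ u₀ = g) :
    transposeMap S B u₁ u₀ hu ∘ₗ transposeMap S B v₁ v₀ hv = LinearMap.id := by
  -- The composite chain map lifts the identity of `X`, so on `P₁` it differs from the identity by
  -- some `s ∘ f`. After dualizing, the difference lies in the range that is divided out.
  obtain ⟨s, hs⟩ := h.exists_homotopy h (u₁ := v₁ ∘ₗ u₁ - LinearMap.id)
    (u₀ := v₀ ∘ₗ u₀ - LinearMap.id)
    (by rw [LinearMap.comp_sub, LinearMap.sub_comp, ← LinearMap.comp_assoc, hv,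
      LinearMap.comp_assoc, hu, LinearMap.comp_assoc]; rfl)
    (by rw [LinearMap.comp_sub, hvu]; simp)
  refine Submodule.linearMap_qext _ (LinearMap.ext fun y => ?_)
  refine (Submodule.Quotient.eq _).2 ⟨y ∘ₗ s, LinearMap.ext fun x => ?_⟩
  have := congrArg y (LinearMap.congr_fun hs x)
  simpa using this.symm

omit [SMulCommClass S R B] in
variable (S B) in
/-- The transpose does not depend on the resolution. -/
lemma IsProjResolution.nonempty_transpose_equiv (h : IsProjResolution f g)
    (h' : IsProjResolution f' g') (e : X ≃ₗ[R] Y) :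
    Nonempty (TransposeOf S B f ≃ₗ[S] TransposeOf S B f') := by
  obtain ⟨u₁, u₀, hu₀, hu⟩ := h.exists_chainMap h' e.toLinearMap
  obtain ⟨v₁, v₀, hv₀, hv⟩ := h'.exists_chainMap h e.symm.toLinearMap
  refine ⟨LinearEquiv.ofLinearMap (transposeMap S B v₁ v₀ hv) (transposeMap S B u₁ u₀ hu)
    (transposeMap_comp_transposeMap_eq_id h' hv hu ?_)
    (transposeMap_comp_transposeMap_eq_id h hu hv ?_)⟩
  · rw [← LinearMap.comp_assoc, hu₀, LinearMap.comp_assoc, hv₀, ← LinearMap.comp_assoc]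
    simp
  · rw [← LinearMap.comp_assoc, hv₀, LinearMap.comp_assoc, hu₀, ← LinearMap.comp_assoc]
    simp

namespace IsDualizingBimodule

variable (h : IsDualizingBimodule R S B)
include h

/-- `Hom(Y, X) = 0` implies `Hom(Tr X, Tr Y) = 0`. -/
lemma transpose_hom_eq_zero (hf : IsProjResolution f g) (hf' : IsProjResolution f' g')
    (h0 : ∀ φ : X →ₗ[R] Y, φ = 0) (t : TransposeOf S B f' →ₗ[S] TransposeOf S B f) : t = 0 := by
  have := hf.finite_one
  have := hf.finite_zero
  have := hf.projective_one
  have := hf.projective_zero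
  have := hf'.finite_one
  have := hf'.finite_zero
  have := hf'.projective_one
  have := hf'.projective_zero
  have : Module.Projective S (Q₁ →ₗ[R] B) := h.projective_dual
  have : Module.Projective S (Q₀ →ₗ[R] B) := h.projective_dual
  -- The map `t` from `Tr Y` to `Tr X` is lifted to the dual presentations. By fullness the lifts
  -- are dual to a chain map from `P₁ → P₀` to `Q₁ → Q₀`, which induces a map `φ` from `X` to `Y`.
  obtain ⟨t₁, ht₁⟩ := Module.projective_lifting_property
    (LinearMap.range (LinearMap.lcomp S B f)).mkQ
    (t ∘ₗ (LinearMap.range (LinearMap.lcomp S B f')).mkQ) (Submodule.mkQ_surjective _)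
  obtain ⟨t₀, ht₀⟩ := (LinearMap.lcomp S B f).exists_lift_of_range_le
    (t₁ ∘ₗ LinearMap.lcomp S B f') fun y => by
      have := LinearMap.congr_fun ht₁ (LinearMap.lcomp S B f' y)
      rw [← Submodule.Quotient.mk_eq_zero]
      exact this.trans (by rw [LinearMap.comp_apply, mkQ_lcomp, map_zero])
  obtain ⟨u₁, rfl⟩ := h.exists_lcomp_eq t₁
  obtain ⟨u₀, rfl⟩ := h.exists_lcomp_eq t₀
  have hu : f' ∘ₗ u₁ = u₀ ∘ₗ f := h.lcomp_injective ht₀.symm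
  obtain ⟨φ, hφ⟩ := LinearMap.exists_factor_of_ker_le hf.surjective (g' ∘ₗ u₀) fun x hx => by
    obtain ⟨z, rfl⟩ := (hf.exact x).1 hx
    have := LinearMap.congr_fun hu z
    simp only [LinearMap.comp_apply] at this
    rw [LinearMap.mem_ker, LinearMap.comp_apply, ← this, hf'.exact.apply_apply_eq_zero]
  rw [h0 φ, LinearMap.zero_comp] at hφ
  -- As `φ = 0`, the chain map is null-homotopic, and so `t` vanishes.
  obtain ⟨s, rfl⟩ := hf.exists_homotopy hf' hu hφ.symm
  refine Submodule.linearMap_qext _ (ht₁.symm.trans (LinearMap.ext fun y => ?_))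
  exact (Submodule.Quotient.mk_eq_zero _).2 ⟨y ∘ₗ s, rfl⟩

/-- There are no nonzero maps from a transpose to the bimodule. -/
lemma transpose_hom_bimodule_eq_zero (hf : IsProjResolution f g)
    (t : TransposeOf S B f →ₗ[S] B) : t = 0 := by
  have := hf.finite_one
  have := hf.finite_zero
  have := hf.projective_one
  have := hf.projective_zero
  -- The composite `P₁* → Tr X → B` is evaluation at some `x`. It kills the image of `P₀*`, which
  -- means `f x = 0`, hence `x = 0`.
  obtain ⟨x, hx⟩ := h.dualEval_surjective (t ∘ₗ Submodule.mkQ _)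
  have hfx : f x = 0 := h.dualEval_injective <| LinearMap.ext fun y => by
    refine (LinearMap.congr_fun hx (LinearMap.lcomp S B f y)).trans ?_
    rw [LinearMap.comp_apply, mkQ_lcomp, map_zero, map_zero, LinearMap.zero_apply]
  refine Submodule.linearMap_qext _ ?_
  rw [← hx, hf.injective (hfx.trans (map_zero f).symm), map_zero, LinearMap.zero_comp]

/-- The kernel of `P₀* → P₁*` is `Hom(X, B)`. -/
lemma isProjResolution_transpose (hf : IsProjResolution f g) (h0 : ∀ φ : X →ₗ[R] B, φ = 0) :
    IsProjResolution (LinearMap.lcomp S B f) (LinearMap.range (LinearMap.lcomp S B f)).mkQ := by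
  have := hf.finite_one
  have := hf.finite_zero
  have := hf.projective_one
  have := hf.projective_zero
  refine ⟨h.finite_dual, h.finite_dual, h.projective_dual, h.projective_dual, ?_,
    fun y => by simp [← LinearMap.mem_range], Submodule.mkQ_surjective _⟩
  refine (injective_iff_map_eq_zero _).2 fun y hy => ?_
  obtain ⟨φ, rfl⟩ := LinearMap.exists_factor_of_ker_le hf.surjective y fun x hx => by
    obtain ⟨z, rfl⟩ := (hf.exact x).1 hx
    exact LinearMap.congr_fun hy z
  rw [h0 φ, LinearMap.zero_comp]

/-- Dualizing `f` twice gives back `f`, whose cokernel is `X`. This computes `Tr Tr X` only when the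
dual sequence is itself a resolution. -/
lemma nonempty_transpose_transpose_equiv (hf : IsProjResolution f g) :
    Nonempty (TransposeOf R B (LinearMap.lcomp S B f) ≃ₗ[R] X) := by
  have := hf.finite_one
  have := hf.finite_zero
  have := hf.projective_one
  have := hf.projective_zero
  let e₀ := LinearEquiv.ofBijective (dualEval R S B P₀) h.dualEval_bijective
  have hmap : Submodule.map e₀.toLinearMap (LinearMap.ker g) =
      LinearMap.range (LinearMap.lcomp R B (LinearMap.lcomp S B f)) := by
    ext y
    constructor
    · rintro ⟨x, hx, rfl⟩
      obtain ⟨z, rfl⟩ := (hf.exact x).1 hx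
      exact ⟨dualEval R S B P₁ z, rfl⟩
    · rintro ⟨z, rfl⟩
      obtain ⟨x, rfl⟩ := h.dualEval_surjective z
      exact ⟨f x, hf.exact.apply_apply_eq_zero x, rfl⟩
  exact ⟨(Submodule.Quotient.equiv _ _ e₀ hmap).symm.trans
    (g.quotKerEquivOfSurjective hf.surjective)⟩

end IsDualizingBimodule

end Bimodule

/-! ### Torsion pairs -/

section TorsionPairs

variable {R : Type w} [Ring R]

lemma CategoryTheory.ObjectProperty.prop_of_linearEquiv (𝒞 : ObjectProperty (FGModuleCat.{w} R))
    [𝒞.IsClosedUnderIsomorphisms] {X Y : FGModuleCat.{w} R} (e : X ≃ₗ[R] Y) (h : 𝒞 X) : 𝒞 Y :=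
  𝒞.prop_of_iso (LinearEquiv.toFGModuleCatIso e : X ≅ Y) h

lemma isClosedUnderIsomorphisms_of_linearEquiv {𝒞 : ObjectProperty (FGModuleCat.{w} R)}
    (h : ∀ X Y : FGModuleCat.{w} R, (X ≃ₗ[R] Y) → 𝒞 X → 𝒞 Y) : 𝒞.IsClosedUnderIsomorphisms :=
  ⟨fun e hX => h _ _ (FGModuleCat.isoToLinearEquiv e) hX⟩

namespace IsTorsionPair

variable {p : ObjectProperty (FGModuleCat.{w} R) × ObjectProperty (FGModuleCat.{w} R)}

lemma fst_iff (h : IsTorsionPair p) (X : FGModuleCat.{w} R) :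
    p.1 X ↔ ∀ Y : FGModuleCat.{w} R, p.2 Y → ∀ f : X →ₗ[R] Y, f = 0 := by
  refine ⟨fun hX Y hY => h.hom_eq_zero X Y hX hY, fun hX => ?_⟩
  obtain ⟨T, F, i, q, hT, hF, hi, hiq, hq⟩ := h.exists_exact X
  have hq0 := hX F hF q
  have hi' : Function.Surjective i := fun x => (hiq x).1 (by rw [hq0]; rfl)
  have := h.iso_closed_fst
  exact p.1.prop_of_linearEquiv (LinearEquiv.ofBijective i ⟨hi, hi'⟩) hT

lemma snd_iff (h : IsTorsionPair p) (Y : FGModuleCat.{w} R) :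
    p.2 Y ↔ ∀ X : FGModuleCat.{w} R, p.1 X → ∀ f : X →ₗ[R] Y, f = 0 := by
  refine ⟨fun hY X hX => h.hom_eq_zero X Y hX hY, fun hY => ?_⟩
  obtain ⟨T, F, i, q, hT, hF, hi, hiq, hq⟩ := h.exists_exact Y
  have hi0 := hY T hT i
  have hq' : Function.Injective q := (injective_iff_map_eq_zero q).2 fun x hx => by
    obtain ⟨y, rfl⟩ := (hiq x).1 hx
    rw [hi0, LinearMap.zero_apply]
  have := h.iso_closed_snd
  exact p.2.prop_of_linearEquiv (LinearEquiv.ofBijective q ⟨hq', hq⟩).symm hF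

/-- The two classes of a torsion pair determine each other by orthogonality, and enlarging one
shrinks the other. -/
lemma eq_of_le {p' : ObjectProperty (FGModuleCat.{w} R) × ObjectProperty (FGModuleCat.{w} R)}
    (h : IsTorsionPair p) (h' : IsTorsionPair p') (h₁ : p.1 ≤ p'.1) (h₂ : p.2 ≤ p'.2) :
    p = p' := by
  refine Prod.ext (le_antisymm h₁ fun X hX => ?_) (le_antisymm h₂ fun Y hY => ?_)
  · exact (h.fst_iff X).2 fun Y hY => h'.hom_eq_zero X Y hX (h₂ Y hY)
  · exact (h.snd_iff Y).2 fun X hX => h'.hom_eq_zero X Y (h₁ X hX) hY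

end IsTorsionPair

lemma isClosedUnderIsomorphisms_sumSubcategory (𝒞 𝒟 : ObjectProperty (FGModuleCat.{w} R)) :
    (sumSubcategory 𝒞 𝒟).IsClosedUnderIsomorphisms :=
  isClosedUnderIsomorphisms_of_linearEquiv fun _ _ e ⟨Y, Z, hY, hZ, ⟨e'⟩⟩ =>
    ⟨Y, Z, hY, hZ, ⟨e.symm.trans e'⟩⟩

lemma sumSubcategory_comm (𝒞 𝒟 : ObjectProperty (FGModuleCat.{w} R)) :
    sumSubcategory 𝒞 𝒟 = sumSubcategory 𝒟 𝒞 := by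
  ext X
  constructor
  · rintro ⟨Y, Z, hY, hZ, ⟨e⟩⟩
    exact ⟨Z, Y, hZ, hY, ⟨e.trans (LinearEquiv.prodComm R Y Z)⟩⟩
  · rintro ⟨Y, Z, hY, hZ, ⟨e⟩⟩
    exact ⟨Z, Y, hZ, hY, ⟨e.trans (LinearEquiv.prodComm R Y Z)⟩⟩

end TorsionPairs

/-! ### The transpose on finitely generated modules -/

section Transpose

variable {R S B : Type w} [Ring R] [Ring S] [AddCommGroup B] [Module R B] [Module S B]
  [SMulCommClass R S B]

/-- `Y ≅ Tr X`, computed from a minimal projective presentation of `X`. -/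
def IsTranspose (S B : Type w) [Ring S] [AddCommGroup B] [Module R B] [Module S B]
    [SMulCommClass R S B] (X : FGModuleCat.{w} R) (Y : FGModuleCat.{w} S) : Prop :=
  ∃ (P₁ P₀ : FGModuleCat.{w} R) (f : P₁ →ₗ[R] P₀) (g : P₀ →ₗ[R] X),
    IsMinimalPresentation f g ∧ Nonempty (Y ≃ₗ[S] TransposeOf S B f)

/-- The modules isomorphic to `Tr X` with `X` in `𝒞`. -/
def transposeClass (S B : Type w) [Ring S] [AddCommGroup B] [Module R B] [Module S B]
    [SMulCommClass R S B] (𝒞 : ObjectProperty (FGModuleCat.{w} R)) :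
    ObjectProperty (FGModuleCat.{w} S) :=
  fun Y => ∃ X, 𝒞 X ∧ IsTranspose S B X Y

/-- `(𝒯, ℱ) ↦ (Tr ℱ, Tr 𝒯 ⊕ 𝒫)`. -/
def transposePair (S B : Type w) [Ring S] [AddCommGroup B] [Module R B] [Module S B]
    [SMulCommClass R S B]
    (p : ObjectProperty (FGModuleCat.{w} R) × ObjectProperty (FGModuleCat.{w} R)) :
    ObjectProperty (FGModuleCat.{w} S) × ObjectProperty (FGModuleCat.{w} S) :=
  (transposeClass S B p.2, sumSubcategory (transposeClass S B p.1) (projectiveModules S))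

variable (R S B) in
/-- Two artinian hereditary rings with a dualizing bimodule. -/
structure IsHereditaryDuality : Prop where
  bimodule : IsDualizingBimodule R S B
  artinian_left : IsArtinianRing R
  artinian_right : IsArtinianRing S
  hereditary_left : IsFGHereditary R
  hereditary_right : IsFGHereditary S

lemma isClosedUnderIsomorphisms_transposeClass (𝒞 : ObjectProperty (FGModuleCat.{w} R)) :
    (transposeClass S B 𝒞).IsClosedUnderIsomorphisms :=
  isClosedUnderIsomorphisms_of_linearEquiv
    fun _ _ e ⟨X, hX, P₁, P₀, f, g, hfg, ⟨e'⟩⟩ => ⟨X, hX, P₁, P₀, f, g, hfg, ⟨e.symm.trans e'⟩⟩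

/-- A finitely generated module over an artinian hereditary ring is the sum of a projective module
and a module without nonzero maps to a given finitely generated projective module. -/
lemma IsFGHereditary.exists_equiv_prod [IsArtinianRing R] (hR : IsFGHereditary R)
    (C : Type w) [AddCommGroup C] [Module R C] [Module.Finite R C] [Module.Projective R C]
    (X : FGModuleCat.{w} R) :
    ∃ X' P : FGModuleCat.{w} R, Module.Projective R P ∧ (∀ φ : X' →ₗ[R] C, φ = 0) ∧
      Nonempty (X ≃ₗ[R] (X' × P)) := by
  -- Choose `φ` from `X` to a projective with minimal kernel. Its range is projective, so the kernel
  -- is a direct summand, with retraction `r`. A nonzero `ψ` from the kernel to `C` would make the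
  -- kernel of `(φ, ψ ∘ r)` strictly smaller.
  obtain ⟨N, ⟨Q, hQ, φ, hφ⟩, hmin⟩ := IsArtinian.set_has_minimal
    {N : Submodule R X | ∃ Q : FGModuleCat.{w} R, Module.Projective R Q ∧
      ∃ φ : X →ₗ[R] Q, LinearMap.ker φ = N}
    ⟨_, FGModuleCat.of R R, inferInstanceAs (Module.Projective R R), (0 : X →ₗ[R] R), rfl⟩
  have hP : Module.Projective R (LinearMap.range φ) := hR Q _
  obtain ⟨s, hs⟩ := Module.projective_lifting_property φ.rangeRestrict LinearMap.id
    φ.surjective_rangeRestrict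
  have hs' (y : LinearMap.range φ) : φ (s y) = y := congr($(LinearMap.congr_fun hs y).1)
  let r : X →ₗ[R] LinearMap.ker φ := (LinearMap.id - s ∘ₗ φ.rangeRestrict).codRestrict _
    fun x => by
      rw [LinearMap.mem_ker, LinearMap.sub_apply, map_sub, LinearMap.comp_apply, hs', sub_eq_zero]
      rfl
  have hr (x : LinearMap.ker φ) : r x = x := by
    have h0 : φ.rangeRestrict (x : X) = 0 := Subtype.ext x.2
    refine Subtype.ext ?_
    change (x : X) - s (φ.rangeRestrict (x : X)) = x
    rw [h0, map_zero, sub_zero]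
  refine ⟨FGModuleCat.of R (LinearMap.ker φ), FGModuleCat.of R (LinearMap.range φ), hP,
    fun ψ => ?_, ⟨LinearEquiv.ofBijective (r.prod φ.rangeRestrict) ⟨?_, ?_⟩⟩⟩
  · change LinearMap.ker φ →ₗ[R] C at ψ
    have hker : LinearMap.ker (φ.prod (ψ ∘ₗ r)) = N := by
      refine LE.le.eq_of_not_lt ?_ (hmin _ ⟨FGModuleCat.of R (Q × C), ?_, φ.prod (ψ ∘ₗ r), rfl⟩)
      · rw [LinearMap.ker_prod]
        exact inf_le_left.trans hφ.le
      · exact inferInstanceAs (Module.Projective R (Q × C))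
    ext x
    have hx : (x : X) ∈ LinearMap.ker (φ.prod (ψ ∘ₗ r)) := by
      rw [hker, ← hφ]
      exact x.2
    have := congr($(LinearMap.mem_ker.1 hx).2)
    simpa [hr] using this
  · refine (injective_iff_map_eq_zero _).2 fun x hx => ?_
    have h1 : (r x : X) = 0 := congr(($hx).1.1)
    have h2 : φ.rangeRestrict x = 0 := congr(($hx).2)
    change x - s (φ.rangeRestrict x) = 0 at h1
    rwa [h2, map_zero, sub_zero] at h1
  · rintro ⟨a, b⟩
    have ha : φ.rangeRestrict (a : X) = 0 := Subtype.ext a.2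
    have hb : φ.rangeRestrict (s b) = b := Subtype.ext (hs' b)
    refine ⟨a + s b, Prod.ext (Subtype.ext ?_) ?_⟩
    · change (a + s b : X) - s (φ.rangeRestrict ((a : X) + s b)) = a
      rw [map_add, ha, hb, zero_add, add_sub_cancel_right]
    · change φ.rangeRestrict ((a : X) + s b) = b
      rw [map_add, ha, hb, zero_add]

namespace IsHereditaryDuality

omit [SMulCommClass R S B] in
lemma symm (h : IsHereditaryDuality R S B) : IsHereditaryDuality S R B :=
  ⟨h.bimodule.symm, h.artinian_right, h.artinian_left, h.hereditary_right, h.hereditary_left⟩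

variable [SMulCommClass S R B] (h : IsHereditaryDuality R S B)
include h

lemma finite_transposeOf {P₁ P₀ : Type*} [AddCommGroup P₁] [Module R P₁] [AddCommGroup P₀]
    [Module R P₀] [Module.Finite R P₁] [Module.Projective R P₁] (f : P₁ →ₗ[R] P₀) :
    Module.Finite S (TransposeOf S B f) :=
  have : Module.Finite S (P₁ →ₗ[R] B) := h.bimodule.finite_dual
  inferInstance

omit [SMulCommClass S R B] in
lemma exists_resolution {X : FGModuleCat.{w} R} {Y : FGModuleCat.{w} S} (hXY : IsTranspose S B X Y) :
    ∃ (P₁ P₀ : FGModuleCat.{w} R) (f : P₁ →ₗ[R] P₀) (g : P₀ →ₗ[R] X),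
      IsProjResolution f g ∧ Nonempty (Y ≃ₗ[S] TransposeOf S B f) := by
  obtain ⟨P₁, P₀, f, g, hfg, e⟩ := hXY
  exact ⟨P₁, P₀, f, g, hfg.isProjResolution h.hereditary_left, e⟩

-- Independence of the resolution removes minimality from all later arguments.
omit [SMulCommClass S R B] in
lemma isTranspose_of_resolution {P₁ P₀ : Type*} [AddCommGroup P₁] [Module R P₁] [AddCommGroup P₀]
    [Module R P₀] {X : FGModuleCat.{w} R} {Y : FGModuleCat.{w} S} {f : P₁ →ₗ[R] P₀}
    {g : P₀ →ₗ[R] X} (hf : IsProjResolution f g) (e : Y ≃ₗ[S] TransposeOf S B f) :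
    IsTranspose S B X Y := by
  have := h.artinian_left
  obtain ⟨Q₁, Q₀, f', g', hf'⟩ := exists_isMinimalPresentation (M := X) h.hereditary_left
  obtain ⟨e'⟩ := hf.nonempty_transpose_equiv S B (hf'.isProjResolution h.hereditary_left)
    (LinearEquiv.refl R X)
  exact ⟨Q₁, Q₀, f', g', hf', ⟨e.trans e'⟩⟩

lemma exists_isTranspose (X : FGModuleCat.{w} R) : ∃ Y : FGModuleCat.{w} S, IsTranspose S B X Y := by
  have := h.artinian_left
  obtain ⟨P₁, P₀, f, g, hf⟩ := exists_isMinimalPresentation (M := X) h.hereditary_left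
  have := hf.projective_one
  have := h.finite_transposeOf f
  exact ⟨FGModuleCat.of S (TransposeOf S B f), P₁, P₀, f, g, hf, ⟨LinearEquiv.refl S _⟩⟩

omit [SMulCommClass S R B] in
lemma isTranspose_congr_left {X X' : FGModuleCat.{w} R} {Y : FGModuleCat.{w} S}
    (hXY : IsTranspose S B X Y) (e : X ≃ₗ[R] X') : IsTranspose S B X' Y := by
  obtain ⟨P₁, P₀, f, g, hf, ⟨e'⟩⟩ := h.exists_resolution hXY
  exact h.isTranspose_of_resolution (hf.congr_right e) e'

-- Adding `P` to both `P₀` and `X` leaves `P₁` unchanged, and the new functionals on `P₀ × P`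
-- restrict to `P₁` in the same way as those on `P₀`.
omit [SMulCommClass S R B] in
lemma isTranspose_prod {X P : FGModuleCat.{w} R} {Y : FGModuleCat.{w} S}
    (hXY : IsTranspose S B X Y) (hP : Module.Projective R P) :
    IsTranspose S B (FGModuleCat.of R (X × P)) Y := by
  obtain ⟨P₁, P₀, f, g, hf, ⟨e⟩⟩ := h.exists_resolution hXY
  have hrange : LinearMap.range (LinearMap.lcomp S B (LinearMap.inl R P₀ P ∘ₗ f)) =
      LinearMap.range (LinearMap.lcomp S B f) := by
    ext y
    constructor
    · rintro ⟨z, rfl⟩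
      exact ⟨z ∘ₗ LinearMap.inl R P₀ P, rfl⟩
    · rintro ⟨z, rfl⟩
      exact ⟨z ∘ₗ LinearMap.fst R P₀ P, rfl⟩
  exact h.isTranspose_of_resolution (X := FGModuleCat.of R (X × P)) (hf.prod (N := P))
    (e.trans (Submodule.quotEquivOfEq _ _ hrange.symm))

lemma isTranspose_symm {X : FGModuleCat.{w} R} {Y : FGModuleCat.{w} S}
    (hXY : IsTranspose S B X Y) (hX : ∀ φ : X →ₗ[R] B, φ = 0) : IsTranspose R B Y X := by
  obtain ⟨P₁, P₀, f, g, hf, ⟨e⟩⟩ := h.exists_resolution hXY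
  obtain ⟨e'⟩ := h.bimodule.nonempty_transpose_transpose_equiv hf
  exact h.symm.isTranspose_of_resolution
    ((h.bimodule.isProjResolution_transpose hf hX).congr_right e.symm) e'.symm

lemma hom_bimodule_eq_zero {X : FGModuleCat.{w} R} {Y : FGModuleCat.{w} S}
    (hXY : IsTranspose S B X Y) (φ : Y →ₗ[S] B) : φ = 0 := by
  obtain ⟨P₁, P₀, f, g, hf, ⟨e⟩⟩ := h.exists_resolution hXY
  have := h.bimodule.transpose_hom_bimodule_eq_zero hf (φ ∘ₗ e.symm.toLinearMap)
  ext y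
  simpa using LinearMap.congr_fun this (e y)

/-- Maps from a finitely generated projective to `B` separate its points. -/
lemma hom_projective_eq_zero {X : FGModuleCat.{w} R} {Y : FGModuleCat.{w} S}
    (hXY : IsTranspose S B X Y) {P : Type*} [AddCommGroup P] [Module S P] [Module.Finite S P]
    [Module.Projective S P] (φ : Y →ₗ[S] P) : φ = 0 := by
  ext y
  refine h.symm.bimodule.dualEval_injective (LinearMap.ext fun ψ => ?_)
  rw [LinearMap.zero_apply, map_zero]
  exact LinearMap.congr_fun (h.hom_bimodule_eq_zero hXY (ψ ∘ₗ φ)) y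

lemma hom_eq_zero {X X' : FGModuleCat.{w} R} {Y Y' : FGModuleCat.{w} S}
    (hXY : IsTranspose S B X Y) (hXY' : IsTranspose S B X' Y') (h0 : ∀ φ : X →ₗ[R] X', φ = 0)
    (t : Y' →ₗ[S] Y) : t = 0 := by
  obtain ⟨P₁, P₀, f, g, hf, ⟨e⟩⟩ := h.exists_resolution hXY
  obtain ⟨Q₁, Q₀, f', g', hf', ⟨e'⟩⟩ := h.exists_resolution hXY'
  have := h.bimodule.transpose_hom_eq_zero hf hf' h0 (e.toLinearMap ∘ₗ t ∘ₗ e'.symm.toLinearMap)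
  ext y
  simpa using LinearMap.congr_fun this (e' y)

/-- The transpose is exact on sequences whose left term has no nonzero maps to `B`. -/
lemma exists_exact {X Y Z : FGModuleCat.{w} R} {i : X →ₗ[R] Y} {q : Y →ₗ[R] Z}
    (hi : Function.Injective i) (hiq : Function.Exact i q) (hq : Function.Surjective q)
    (hX : ∀ φ : X →ₗ[R] B, φ = 0) {Y' : FGModuleCat.{w} S} (hY' : IsTranspose S B Y Y') :
    ∃ (Z' X' : FGModuleCat.{w} S) (j : Z' →ₗ[S] Y') (r : Y' →ₗ[S] X'), IsTranspose S B Z Z' ∧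
      IsTranspose S B X X' ∧ Function.Injective j ∧ Function.Exact j r ∧
      Function.Surjective r := by
  have := h.artinian_left
  obtain ⟨P₁, P₀, f, g, hf, ⟨e⟩⟩ := h.exists_resolution hY'
  have := hf.finite_one
  have := hf.finite_zero
  have := hf.projective_one
  have := hf.projective_zero
  -- The preimage `W` of `X` in `P₀` gives resolutions `0 → W → P₀ → Z → 0` and `0 → P₁ → W → X →
  -- 0`. The three transposes are the cokernels of `P₀* → W*`, `P₀* → P₁*` and `W* → P₁*`.
  let W : Submodule R P₀ := LinearMap.ker (q ∘ₗ g)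
  have hW : Module.Projective R W := h.hereditary_left P₀ W
  let f₁ : P₁ →ₗ[R] W := f.codRestrict W fun x => by
    rw [LinearMap.mem_ker, LinearMap.comp_apply, hf.exact.apply_apply_eq_zero, map_zero]
  have hresZ : IsProjResolution W.subtype (q ∘ₗ g) :=
    ⟨inferInstance, hf.finite_zero, hW, hf.projective_zero, W.injective_subtype,
      fun x => by simp [W], hq.comp hf.surjective⟩
  let e' := LinearEquiv.ofInjective i hi
  have hgW (x : W) : g x ∈ LinearMap.range i := (hiq _).1 x.2
  let g₁ : W →ₗ[R] X := e'.symm.toLinearMap ∘ₗ (g ∘ₗ W.subtype).codRestrict _ hgW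
  have hg₁ (x : W) : i (g₁ x) = g x := congr($(e'.apply_symm_apply ⟨g x, hgW x⟩).1)
  have hresX : IsProjResolution f₁ g₁ := by
    refine ⟨hf.finite_one, inferInstance, hf.projective_one, hW,
      fun x y hxy => hf.injective congr(($hxy).1), fun x => ?_, fun x => ?_⟩
    · rw [← map_eq_zero_iff i hi, hg₁, hf.exact]
      exact ⟨fun ⟨y, hy⟩ => ⟨y, Subtype.ext hy⟩, fun ⟨y, hy⟩ => ⟨y, congr(($hy).1)⟩⟩
    · obtain ⟨y, hy⟩ := hf.surjective (i x)
      refine ⟨⟨y, ?_⟩, hi ?_⟩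
      · rw [LinearMap.mem_ker, LinearMap.comp_apply, hy, hiq.apply_apply_eq_zero]
      · rw [hg₁, hy]
  -- The left end is exact because `W* → P₁*` is injective, its kernel being `Hom(X, B)`.
  have hinj := (h.bimodule.isProjResolution_transpose hresX hX).injective
  have := h.finite_transposeOf W.subtype
  have := h.finite_transposeOf f₁
  let j : TransposeOf S B W.subtype →ₗ[S] TransposeOf S B f :=
    transposeMap S B f₁ LinearMap.id rfl
  let r : TransposeOf S B f →ₗ[S] TransposeOf S B f₁ :=
    transposeMap S B LinearMap.id W.subtype rfl
  have hj : Function.Injective j := by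
    refine (injective_iff_map_eq_zero j).2 fun y => ?_
    induction y using Submodule.Quotient.induction_on with
    | H y =>
      intro hy
      obtain ⟨z, hz⟩ := (Submodule.Quotient.mk_eq_zero _).1 hy
      refine (Submodule.Quotient.mk_eq_zero _).2 ⟨z, hinj hz⟩
  have hjr : Function.Exact j r := by
    intro y
    induction y using Submodule.Quotient.induction_on with
    | H y =>
      constructor
      · intro hy
        obtain ⟨z, hz⟩ := (Submodule.Quotient.mk_eq_zero _).1 hy
        exact ⟨Submodule.Quotient.mk z, congrArg Submodule.Quotient.mk hz⟩
      · rintro ⟨z, hz⟩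
        rw [← hz]
        clear hz
        induction z using Submodule.Quotient.induction_on with
        | H z => exact (Submodule.Quotient.mk_eq_zero _).2 ⟨z, rfl⟩
  have hr : Function.Surjective r := by
    intro y
    induction y using Submodule.Quotient.induction_on with
    | H y => exact ⟨Submodule.Quotient.mk y, rfl⟩
  refine ⟨FGModuleCat.of S (TransposeOf S B W.subtype), FGModuleCat.of S (TransposeOf S B f₁),
    e.symm.toLinearMap ∘ₗ j, r ∘ₗ e.toLinearMap,
    h.isTranspose_of_resolution hresZ (LinearEquiv.refl S _),
    h.isTranspose_of_resolution hresX (LinearEquiv.refl S _), e.symm.injective.comp hj, ?_,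
    hr.comp e.surjective⟩
  intro y
  rw [LinearMap.comp_apply, LinearEquiv.coe_coe, hjr]
  exact ⟨fun ⟨z, hz⟩ => ⟨z, by simp [hz]⟩, fun ⟨z, hz⟩ => ⟨z, by simp [← hz]⟩⟩

/-- Up to a projective summand, a module over `S` is `Tr Y`. The torsion sequence `0 → T → Y → F →
0` has `Hom(T, B) = 0`, since `B` is torsion-free, so it transposes to `0 → Tr F → Tr Y → Tr T → 0`;
the projective summand joins the torsion-free quotient. -/
lemma isTorsionPair_transposePair
    {p : ObjectProperty (FGModuleCat.{w} R) × ObjectProperty (FGModuleCat.{w} R)}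
    (hp : p ∈ torsionPairsTwo R) : IsTorsionPair (transposePair S B p) where
  iso_closed_fst := isClosedUnderIsomorphisms_transposeClass _
  iso_closed_snd := isClosedUnderIsomorphisms_sumSubcategory _ _
  hom_eq_zero := by
    rintro U W ⟨F, hF, hFU⟩ ⟨T', P, ⟨T, hT, hTT'⟩, hP, ⟨e⟩⟩ φ
    have : Module.Projective S P := hP
    have h1 := h.hom_eq_zero hTT' hFU (hp.1.hom_eq_zero T F hT hF)
      (LinearMap.fst S T' P ∘ₗ e.toLinearMap ∘ₗ φ)
    have h2 := h.hom_projective_eq_zero hFU (LinearMap.snd S T' P ∘ₗ e.toLinearMap ∘ₗ φ)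
    ext x
    refine e.injective (Prod.ext ?_ ?_)
    · simpa using LinearMap.congr_fun h1 x
    · simpa using LinearMap.congr_fun h2 x
  exists_exact := by
    intro X
    have := h.artinian_right
    have := h.bimodule.finite_right
    have := h.bimodule.projective_right
    obtain ⟨X', P, hP, hX', ⟨e⟩⟩ := h.hereditary_right.exists_equiv_prod B X
    obtain ⟨Y, hXY⟩ := h.symm.exists_isTranspose X'
    have hYX := h.symm.isTranspose_symm hXY hX'
    obtain ⟨T, F, i, q, hT, hF, hi, hiq, hq⟩ := hp.1.exists_exact Y
    have := h.bimodule.finite_left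
    have hTB : ∀ φ : T →ₗ[R] B, φ = 0 :=
      hp.1.hom_eq_zero T (FGModuleCat.of R B) hT (hp.2 _ h.bimodule.projective_left)
    obtain ⟨F', T', j, r, hFF', hTT', hj, hjr, hr⟩ := h.exists_exact hi hiq hq hTB hYX
    refine ⟨F', FGModuleCat.of S (T' × P), e.symm.toLinearMap ∘ₗ LinearMap.inl S X' P ∘ₗ j,
      r.prodMap LinearMap.id ∘ₗ e.toLinearMap, ⟨F, hF, hFF'⟩,
      ⟨T', P, ⟨T, hT, hTT'⟩, hP, ⟨LinearEquiv.refl S _⟩⟩,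
      e.symm.injective.comp (LinearMap.inl_injective.comp hj), ?_,
      (Function.Surjective.prodMap hr Function.surjective_id).comp e.surjective⟩
    intro x
    obtain ⟨⟨a, b⟩, rfl⟩ := e.symm.surjective x
    rw [LinearMap.comp_apply, LinearEquiv.coe_coe, LinearEquiv.apply_symm_apply]
    change ((r a, b) : T' × P) = 0 ↔ _
    rw [Prod.mk_eq_zero, hjr a]
    constructor
    · rintro ⟨⟨z, hz⟩, rfl⟩
      exact ⟨z, congrArg e.symm (Prod.ext hz rfl)⟩
    · rintro ⟨z, hz⟩
      have hz' := e.symm.injective hz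
      exact ⟨⟨z, congrArg Prod.fst hz'⟩, (congrArg Prod.snd hz').symm⟩

lemma transposePair_mem
    {p : ObjectProperty (FGModuleCat.{w} R) × ObjectProperty (FGModuleCat.{w} R)}
    (hp : p ∈ torsionPairsTwo R) : transposePair S B p ∈ torsionPairsTwo S := by
  refine ⟨h.isTorsionPair_transposePair hp, fun P hP => ?_⟩
  refine ((h.isTorsionPair_transposePair hp).snd_iff P).2 ?_
  rintro U ⟨F, hF, hFU⟩ φ
  have : Module.Projective S P := hP
  exact h.hom_projective_eq_zero hFU φ

/-- Between torsion pairs, two inclusions suffice. Torsion modules satisfy `X ≅ Tr Tr X`; a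
torsion-free `X` is `X' × P` with `X' ≅ Tr Tr X'`, and `Tr X' ≅ Tr X`. -/
lemma transposePair_transposePair
    {p : ObjectProperty (FGModuleCat.{w} R) × ObjectProperty (FGModuleCat.{w} R)}
    (hp : p ∈ torsionPairsTwo R) : transposePair R B (transposePair S B p) = p := by
  refine (hp.1.eq_of_le (h.symm.isTorsionPair_transposePair (h.transposePair_mem hp)) ?_ ?_).symm
  · intro X hX
    have := h.bimodule.finite_left
    have hXB : ∀ φ : X →ₗ[R] B, φ = 0 :=
      hp.1.hom_eq_zero X (FGModuleCat.of R B) hX (hp.2 _ h.bimodule.projective_left)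
    obtain ⟨Y, hXY⟩ := h.exists_isTranspose X
    refine ⟨Y, ⟨Y, FGModuleCat.of S PUnit.{w + 1}, ⟨X, hX, hXY⟩,
      inferInstanceAs (Module.Projective S PUnit.{w + 1}), ⟨LinearEquiv.prodUnique.symm⟩⟩,
      h.isTranspose_symm hXY hXB⟩
  · intro X hX
    have := h.artinian_left
    have := h.bimodule.finite_left
    have := h.bimodule.projective_left
    obtain ⟨X', P, hP, hX', ⟨e⟩⟩ := h.hereditary_left.exists_equiv_prod B X
    obtain ⟨Y, hXY⟩ := h.exists_isTranspose X'
    exact ⟨X', P, ⟨Y, ⟨X, hX, h.isTranspose_congr_left (h.isTranspose_prod hXY hP) e.symm⟩,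
      h.isTranspose_symm hXY hX'⟩, hP, ⟨e⟩⟩

end IsHereditaryDuality

end Transpose

/-! ### Duality over the ground field -/

section TwistedDual

variable {K R S : Type*} [Field K] [Ring R] [Ring S] [Algebra K R] [Algebra K S]

/-- The `K`-linear functionals on the `R`-module `M`, regarded as an `S`-module through an
isomorphism `S ≃ Rᵐᵒᵖ`. -/
def TwistedDual (_θ : S ≃ₐ[K] Rᵐᵒᵖ) (M : Type*) [AddCommGroup M] [Module R M] :
    AddSubgroup (M →+ K) where
  carrier := {f | ∀ (k : K) (m : M), f (algebraMap K R k • m) = k * f m}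
  add_mem' hf hg k m := by rw [AddMonoidHom.add_apply, hf, hg, ← mul_add]; rfl
  zero_mem' k m := (mul_zero k).symm
  neg_mem' hf k m := by rw [AddMonoidHom.neg_apply, hf, ← mul_neg]; rfl

namespace TwistedDual

variable {θ : S ≃ₐ[K] Rᵐᵒᵖ} {θ' : R ≃ₐ[K] Sᵐᵒᵖ}
  {M N : Type*} [AddCommGroup M] [Module R M] [AddCommGroup N] [Module R N]

instance : CoeFun (TwistedDual θ M) fun _ => M → K := ⟨fun f => f.1⟩

@[ext]
lemma ext {f g : TwistedDual θ M} (h : ∀ m, f m = g m) : f = g :=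
  Subtype.ext (AddMonoidHom.ext h)

lemma map_algebraMap_smul (f : TwistedDual θ M) (k : K) (m : M) :
    f (algebraMap K R k • m) = k * f m := f.2 k m

lemma algebraMap_smul_smul (k : K) (r : R) (m : M) :
    r • algebraMap K R k • m = algebraMap K R k • r • m := by
  rw [← mul_smul, ← mul_smul, Algebra.commutes]

instance : Module S (TwistedDual θ M) where
  smul s f := ⟨f.1.comp (DistribSMul.toAddMonoidHom M (θ s).unop), fun k m => by
    rw [AddMonoidHom.comp_apply, AddMonoidHom.comp_apply, DistribSMul.toAddMonoidHom_apply,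
      algebraMap_smul_smul]
    exact f.2 _ _⟩
  one_smul f := ext fun m => by
    change f ((θ 1).unop • m) = f m
    rw [map_one, MulOpposite.unop_one, one_smul]
  mul_smul a b f := ext fun m => by
    change f ((θ (a * b)).unop • m) = f ((θ b).unop • (θ a).unop • m)
    rw [map_mul, MulOpposite.unop_mul, mul_smul]
  smul_zero _ := rfl
  smul_add _ _ _ := rfl
  add_smul a b f := ext fun m => by
    change f ((θ (a + b)).unop • m) = f ((θ a).unop • m) + f ((θ b).unop • m)
    rw [map_add, MulOpposite.unop_add, add_smul]
    exact map_add f.1 _ _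
  zero_smul f := ext fun m => by
    change f ((θ 0).unop • m) = 0
    rw [map_zero, MulOpposite.unop_zero, zero_smul]
    exact map_zero f.1

lemma smul_apply (s : S) (f : TwistedDual θ M) (m : M) : (s • f) m = f ((θ s).unop • m) := rfl

lemma map_add' (f : TwistedDual θ M) (m m' : M) : f (m + m') = f m + f m' := map_add f.1 m m'

variable (θ) in
/-- Functoriality of the dual. -/
def map (φ : M →ₗ[R] N) : TwistedDual θ N →ₗ[S] TwistedDual θ M where
  toFun f := ⟨f.1.comp φ.toAddMonoidHom, fun k m => by
    change f (φ (algebraMap K R k • m)) = k * f (φ m)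
    rw [map_smul]
    exact f.2 _ _⟩
  map_add' _ _ := rfl
  map_smul' s f := ext fun m => congrArg (fun n => f n) (φ.map_smul (θ s).unop m).symm

lemma map_apply (φ : M →ₗ[R] N) (f : TwistedDual θ N) (m : M) : map θ φ f m = f (φ m) := rfl

variable (θ) in
/-- The dual of an isomorphism. -/
def mapEquiv (e : M ≃ₗ[R] N) : TwistedDual θ N ≃ₗ[S] TwistedDual θ M :=
  LinearEquiv.ofLinearMap (map θ e.toLinearMap) (map θ e.symm.toLinearMap)
    (LinearMap.ext fun f => ext fun m => congrArg (fun m => f m) (e.symm_apply_apply m))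
    (LinearMap.ext fun f => ext fun n => congrArg (fun n => f n) (e.apply_symm_apply n))

variable (θ) in
/-- The dual as the space of linear functionals. -/
def equivDual (M : Type*) [AddCommGroup M] [Module R M] [Module K M] [IsScalarTower K R M] :
    TwistedDual θ M ≃+ Module.Dual K M where
  toFun f :=
    { toFun := f
      map_add' := map_add' f
      map_smul' := fun k m => by
        rw [← algebraMap_smul R k m]
        exact f.2 k m }
  invFun f := ⟨f.toAddMonoidHom, fun k m => by
    change f (algebraMap K R k • m) = k * f m
    rw [algebraMap_smul, map_smul, smul_eq_mul]⟩
  left_inv _ := rfl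
  right_inv _ := rfl
  map_add' _ _ := rfl

lemma map_surjective {φ : M →ₗ[R] N} (hφ : Function.Injective φ) :
    Function.Surjective (map θ φ) := by
  let : Module K M := Module.compHom M (algebraMap K R)
  have : IsScalarTower K R M := IsScalarTower.of_algebraMap_smul fun _ _ => rfl
  let : Module K N := Module.compHom N (algebraMap K R)
  have : IsScalarTower K R N := IsScalarTower.of_algebraMap_smul fun _ _ => rfl
  intro f
  obtain ⟨ρ, hρ⟩ := (φ.restrictScalars K).exists_leftInverse_of_injective
    (LinearMap.ker_eq_bot.2 hφ)
  refine ⟨(equivDual θ N).symm (equivDual θ M f ∘ₗ ρ), ext fun m => ?_⟩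
  exact congrArg (fun m => f m) (LinearMap.congr_fun hρ m)

lemma map_injective {φ : M →ₗ[R] N} (hφ : Function.Surjective φ) :
    Function.Injective (map θ φ) := by
  refine (injective_iff_map_eq_zero _).2 fun f hf => ext fun n => ?_
  obtain ⟨m, rfl⟩ := hφ n
  exact congr(($hf : TwistedDual θ M) m)

lemma eq_zero_of_forall_apply_eq_zero (θ : S ≃ₐ[K] Rᵐᵒᵖ) {m : M}
    (h : ∀ f : TwistedDual θ M, f m = 0) : m = 0 := by
  let : Module K M := Module.compHom M (algebraMap K R)
  have : IsScalarTower K R M := IsScalarTower.of_algebraMap_smul fun _ _ => rfl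
  exact (Module.forall_dual_apply_eq_zero_iff K m).1 fun f => h ((equivDual θ M).symm f)

lemma exact_map {L : Type*} [AddCommGroup L] [Module R L] {φ : M →ₗ[R] N} {ψ : N →ₗ[R] L}
    (h : Function.Exact φ ψ) (hψ : Function.Surjective ψ) :
    Function.Exact (map θ ψ) (map θ φ) := by
  intro f
  constructor
  · intro hf
    -- The functional is first factored as an additive map; surjectivity of `ψ` then yields
    -- compatibility with `K`.
    have hker : LinearMap.ker ψ.toAddMonoidHom.toIntLinearMap ≤
        LinearMap.ker f.1.toIntLinearMap := by
      intro n hn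
      obtain ⟨m, rfl⟩ := (h n).1 hn
      exact congr(($hf : TwistedDual θ M) m)
    obtain ⟨g, hg⟩ := LinearMap.exists_factor_of_ker_le
      (g := ψ.toAddMonoidHom.toIntLinearMap) hψ f.1.toIntLinearMap hker
    have hg' (n : N) : g (ψ n) = f n := LinearMap.congr_fun hg n
    refine ⟨⟨g.toAddMonoidHom, fun k l => ?_⟩, ext hg'⟩
    obtain ⟨n, rfl⟩ := hψ l
    change g (algebraMap K R k • ψ n) = k * g (ψ n)
    rw [← map_smul, hg', hg', map_algebraMap_smul]
  · rintro ⟨g, rfl⟩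
    refine ext fun m => ?_
    rw [map_apply, map_apply, h.apply_apply_eq_zero]
    exact map_zero g.1

lemma finite [Module.Finite K R] [Module.Finite R M] : Module.Finite S (TwistedDual θ M) := by
  let : Module K M := Module.compHom M (algebraMap K R)
  have : IsScalarTower K R M := IsScalarTower.of_algebraMap_smul fun _ _ => rfl
  have : Module.Finite K M := Module.Finite.trans R M
  let : Module K (TwistedDual θ M) := Module.compHom _ (algebraMap K S)
  have : IsScalarTower K S (TwistedDual θ M) := IsScalarTower.of_algebraMap_smul fun _ _ => rfl
  let e : TwistedDual θ M ≃ₗ[K] Module.Dual K M :=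
    { equivDual θ M with
      map_smul' := fun k f => LinearMap.ext fun m => by
        change f ((θ (algebraMap K S k)).unop • m) = k * f m
        rw [θ.commutes]
        exact f.2 k m }
  have : Module.Finite K (TwistedDual θ M) := Module.Finite.equiv e.symm
  exact Module.Finite.of_restrictScalars_finite K S _

section Swap

variable {Y : Type*} [AddCommGroup Y] [Module S Y]

/-- The adjunction between the two duals. -/
def swap (h : ∀ r, θ (θ' r).unop = MulOpposite.op r) (φ : Y →ₗ[S] TwistedDual θ M) :
    M →ₗ[R] TwistedDual θ' Y where
  toFun m := ⟨{ toFun := fun y => φ y m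
                map_zero' := by rw [map_zero]; rfl
                map_add' := fun y y' => by rw [map_add]; rfl }, fun k y => by
    change φ (algebraMap K S k • y) m = k * φ y m
    rw [map_smul, smul_apply, θ.commutes]
    exact (φ y).2 k m⟩
  map_add' m m' := ext fun y => TwistedDual.map_add' (φ y) m m'
  map_smul' r m := ext fun y => by
    change φ y (r • m) = φ ((θ' r).unop • y) m
    rw [φ.map_smul, smul_apply, h]
    rfl

variable (h : ∀ r, θ (θ' r).unop = MulOpposite.op r)

lemma swap_apply (φ : Y →ₗ[S] TwistedDual θ M) (m : M) (y : Y) : swap h φ m y = φ y m := rfl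

/-- The adjoint of the identity is the biduality map, and `M` is finite-dimensional over `K`. The
condition `h` makes `θ` and `θ'` inverse to each other up to passing to opposite rings. -/
lemma swap_id_bijective [Module.Finite K R] [Module.Finite R M] :
    Function.Bijective (swap h (LinearMap.id : TwistedDual θ M →ₗ[S] TwistedDual θ M)) := by
  let : Module K M := Module.compHom M (algebraMap K R)
  have : IsScalarTower K R M := IsScalarTower.of_algebraMap_smul fun _ _ => rfl
  have : Module.Finite K M := Module.Finite.trans R M
  refine ⟨(injective_iff_map_eq_zero _).2 fun m hm =>
    eq_zero_of_forall_apply_eq_zero θ fun f => congr(($hm : TwistedDual θ' _) f), fun Φ => ?_⟩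
  let Ψ : Module.Dual K (Module.Dual K M) :=
    { toFun := fun f => Φ ((equivDual θ M).symm f)
      map_add' := fun f g => by rw [map_add]; exact TwistedDual.map_add' Φ _ _
      map_smul' := fun k f => by
        rw [RingHom.id_apply, smul_eq_mul, ← map_algebraMap_smul Φ]
        refine congrArg Φ (ext fun m => ?_)
        rw [smul_apply, θ.commutes]
        exact (map_algebraMap_smul ((equivDual θ M).symm f) k m).symm }
  obtain ⟨m, hm⟩ := (Module.bijective_dual_eval K M).2 Ψ
  exact ⟨m, ext fun f => LinearMap.congr_fun hm (equivDual θ M f)⟩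

end Swap

end TwistedDual

end TwistedDual

/-- Baer's criterion: left ideals are projective, so a map from an ideal to the quotient lifts to
`I`, where it extends. -/
lemma IsFGHereditary.injective_of_surjective {R : Type w} [Ring R] (hR : IsFGHereditary R)
    {I C : Type w} [AddCommGroup I] [Module R I] [AddCommGroup C] [Module R C]
    (hI : Module.Injective R I) (q : I →ₗ[R] C) (hq : Function.Surjective q) :
    Module.Injective R C := by
  refine Module.Baer.injective fun J φ => ?_
  have : Module.Projective R J := hR R J
  obtain ⟨ψ, hψ⟩ := Module.projective_lifting_property q φ hq
  obtain ⟨χ, hχ⟩ := Module.Baer.of_injective hI J ψ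
  exact ⟨q ∘ₗ χ, fun x hx => by
    rw [LinearMap.comp_apply, hχ x hx]
    exact LinearMap.congr_fun hψ _⟩

/-! ### Duality between projectives and injectives, and on torsion pairs -/

section DualPair

variable {K : Type uK} {R S : Type (max uK w)} [Field K] [Ring R] [Ring S] [Algebra K R]
  [Algebra K S] [Module.Finite K R] [Module.Finite K S] {θ : S ≃ₐ[K] Rᵐᵒᵖ} {θ' : R ≃ₐ[K] Sᵐᵒᵖ}

namespace TwistedDual

variable (h : ∀ r, θ (θ' r).unop = MulOpposite.op r) (h' : ∀ s, θ' (θ s).unop = MulOpposite.op s)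
include h h'

-- By adjunction, extending a map from an ideal `I` to the dual of `P` amounts to lifting a map from
-- `P` along the surjection `D S → D I`.
omit [Module.Finite K R] [Module.Finite K S] in
lemma injective_of_projective {P : Type (max uK w)} [AddCommGroup P] [Module R P]
    [Module.Projective R P] : Module.Injective S (TwistedDual θ P) := by
  refine Module.Baer.injective fun I φ => ?_
  obtain ⟨ψ, hψ⟩ := Module.projective_lifting_property (map θ' I.subtype) (swap h φ)
    (map_surjective I.injective_subtype)
  refine ⟨swap h' ψ, fun x hx => ext fun p => ?_⟩
  exact congr(($(LinearMap.congr_fun hψ p) : TwistedDual θ' I) ⟨x, hx⟩)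

/-- A surjection from `Sⁿ` onto `D I` is adjoint to an embedding of `I` into `D (Sⁿ)`. That
embedding splits, and the dual of the retraction, read through `D D (Sⁿ) ≅ Sⁿ`, is a section of the
surjection. -/
lemma projective_of_injective {I : Type (max uK w)} [AddCommGroup I] [Module R I]
    [Module.Finite R I] (hI : Module.Injective R I) : Module.Projective S (TwistedDual θ I) := by
  have : Module.Finite S (TwistedDual θ I) := finite
  obtain ⟨n, π, hπ⟩ := Module.Finite.exists_fin' S (TwistedDual θ I)
  have hinj : Function.Injective (swap h π) := (injective_iff_map_eq_zero _).2 fun x hx =>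
    eq_zero_of_forall_apply_eq_zero θ fun f => by
      obtain ⟨y, rfl⟩ := hπ f
      exact congr(($hx : TwistedDual θ' _) y)
  obtain ⟨ρ, hρ⟩ := hI.out (swap h π) hinj LinearMap.id
  let e := LinearEquiv.ofBijective _ (swap_id_bijective (M := Fin n → S) h')
  refine Module.Projective.of_split (e.symm.toLinearMap ∘ₗ map θ ρ) π
    (LinearMap.ext fun f => ext fun x => ?_)
  have h1 := congr(($(e.apply_symm_apply (map θ ρ f)) : TwistedDual θ _) (swap h π x))
  refine Eq.trans ?_ (h1.trans (congrArg (fun m => f m) (hρ x)))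
  rfl

/-- Heredity passes to the other side: `D N` is a quotient of the injective `D P`, hence injective,
and `N ≅ D D N` is projective. -/
lemma isFGHereditary (hR : IsFGHereditary R) : IsFGHereditary S := by
  intro P _ _ _ _ N
  have : IsArtinianRing S := IsArtinianRing.of_finite K S
  have : Module.Finite R (TwistedDual θ' N) := finite
  have hP : Module.Injective R (TwistedDual θ' P) := injective_of_projective h' h
  have hN : Module.Injective R (TwistedDual θ' N) :=
    hR.injective_of_surjective hP (map θ' N.subtype) (map_surjective N.injective_subtype)
  have hDN : Module.Projective S (TwistedDual θ (TwistedDual θ' N)) :=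
    projective_of_injective h h' hN
  exact Module.Projective.of_equiv
    (LinearEquiv.ofBijective _ (swap_id_bijective (M := N) h')).symm

end TwistedDual

/-- The dual of a finitely generated module. -/
def fgDual (θ : S ≃ₐ[K] Rᵐᵒᵖ) (X : FGModuleCat.{max uK w} R) : FGModuleCat.{max uK w} S :=
  have : Module.Finite S (TwistedDual θ X) := TwistedDual.finite
  FGModuleCat.of S (TwistedDual θ X)

/-- The modules isomorphic to the dual of a module in `𝒞`. -/
def dualClass (θ : S ≃ₐ[K] Rᵐᵒᵖ) (𝒞 : ObjectProperty (FGModuleCat.{max uK w} R)) :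
    ObjectProperty (FGModuleCat.{max uK w} S) :=
  fun Y => ∃ X, 𝒞 X ∧ Nonempty (Y ≃ₗ[S] TwistedDual θ X)

/-- `(𝒯, ℱ) ↦ (D ℱ, D 𝒯)`. -/
def dualPair (θ : S ≃ₐ[K] Rᵐᵒᵖ)
    (p : ObjectProperty (FGModuleCat.{max uK w} R) × ObjectProperty (FGModuleCat.{max uK w} R)) :
    ObjectProperty (FGModuleCat.{max uK w} S) × ObjectProperty (FGModuleCat.{max uK w} S) :=
  (dualClass θ p.2, dualClass θ p.1)

omit [Module.Finite K R] [Module.Finite K S] in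
lemma isClosedUnderIsomorphisms_dualClass (𝒞 : ObjectProperty (FGModuleCat.{max uK w} R)) :
    (dualClass θ 𝒞).IsClosedUnderIsomorphisms :=
  isClosedUnderIsomorphisms_of_linearEquiv fun _ _ e ⟨X, hX, ⟨e'⟩⟩ => ⟨X, hX, ⟨e.symm.trans e'⟩⟩

/-- The biduality isomorphism. -/
def bidualEquiv (h : ∀ r, θ (θ' r).unop = MulOpposite.op r) (X : FGModuleCat.{max uK w} R) :
    X ≃ₗ[R] TwistedDual θ' (fgDual θ X) :=
  LinearEquiv.ofBijective _ (TwistedDual.swap_id_bijective (M := X) h)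

omit [Module.Finite K S] in
lemma dualClass_dualClass (h : ∀ r, θ (θ' r).unop = MulOpposite.op r)
    (𝒞 : ObjectProperty (FGModuleCat.{max uK w} R)) [𝒞.IsClosedUnderIsomorphisms] :
    dualClass θ' (dualClass θ 𝒞) = 𝒞 := by
  ext X
  constructor
  · rintro ⟨Y, ⟨Z, hZ, ⟨e⟩⟩, ⟨e'⟩⟩
    exact 𝒞.prop_of_linearEquiv
      ((bidualEquiv h Z).trans ((TwistedDual.mapEquiv θ' e).trans e'.symm)) hZ
  · intro hX
    exact ⟨fgDual θ X, ⟨X, hX, ⟨LinearEquiv.refl S _⟩⟩, ⟨bidualEquiv h X⟩⟩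

omit [Module.Finite K S] in
lemma dualPair_dualPair (h : ∀ r, θ (θ' r).unop = MulOpposite.op r)
    {p : ObjectProperty (FGModuleCat.{max uK w} R) × ObjectProperty (FGModuleCat.{max uK w} R)}
    (hp : IsTorsionPair p) : dualPair θ' (dualPair θ p) = p :=
  have := hp.iso_closed_fst
  have := hp.iso_closed_snd
  Prod.ext (dualClass_dualClass h p.1) (dualClass_dualClass h p.2)

lemma isTorsionPair_dualPair (h : ∀ r, θ (θ' r).unop = MulOpposite.op r)
    (h' : ∀ s, θ' (θ s).unop = MulOpposite.op s)
    {p : ObjectProperty (FGModuleCat.{max uK w} R) × ObjectProperty (FGModuleCat.{max uK w} R)}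
    (hp : IsTorsionPair p) : IsTorsionPair (dualPair θ p) where
  iso_closed_fst := isClosedUnderIsomorphisms_dualClass _
  iso_closed_snd := isClosedUnderIsomorphisms_dualClass _
  hom_eq_zero := by
    rintro U W ⟨F, hF, ⟨e⟩⟩ ⟨T, hT, ⟨e'⟩⟩ φ
    let ψ : TwistedDual θ F →ₗ[S] TwistedDual θ T :=
      e'.toLinearMap ∘ₗ φ ∘ₗ e.symm.toLinearMap
    -- A map `D F → D T` is adjoint to a map `T → D D F ≅ F`, which is zero.
    have h0 := hp.hom_eq_zero T F hT hF ((bidualEquiv h F).symm.toLinearMap ∘ₗ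
      (TwistedDual.swap h ψ : T →ₗ[R] TwistedDual θ' (TwistedDual θ F)))
    have h1 (t : T) : TwistedDual.swap h ψ t = 0 := by
      have := LinearMap.congr_fun h0 t
      exact (LinearEquiv.map_eq_zero_iff (bidualEquiv h F).symm).1 this
    ext x
    refine e'.injective (TwistedDual.ext fun t => ?_)
    have := congr(($(h1 t) : TwistedDual θ' _) (e x))
    rw [TwistedDual.swap_apply] at this
    simpa [ψ] using this
  exists_exact := by
    intro X
    obtain ⟨T, F, i, q, hT, hF, hi, hiq, hq⟩ := hp.exists_exact (fgDual θ' X)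
    let e := bidualEquiv h' X
    refine ⟨fgDual θ F, fgDual θ T, e.symm.toLinearMap ∘ₗ TwistedDual.map θ q,
      TwistedDual.map θ i ∘ₗ e.toLinearMap, ⟨F, hF, ⟨LinearEquiv.refl S _⟩⟩,
      ⟨T, hT, ⟨LinearEquiv.refl S _⟩⟩, e.symm.injective.comp (TwistedDual.map_injective hq), ?_,
      (TwistedDual.map_surjective hi).comp e.surjective⟩
    intro x
    refine (TwistedDual.exact_map hiq hq (e x)).trans ?_
    exact ⟨fun ⟨z, hz⟩ => ⟨z, e.symm_apply_eq.2 hz⟩, fun ⟨z, hz⟩ => ⟨z, e.symm_apply_eq.1 hz⟩⟩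

lemma dualPair_mem_two (h : ∀ r, θ (θ' r).unop = MulOpposite.op r)
    (h' : ∀ s, θ' (θ s).unop = MulOpposite.op s)
    {p : ObjectProperty (FGModuleCat.{max uK w} R) × ObjectProperty (FGModuleCat.{max uK w} R)}
    (hp : p ∈ torsionPairsOne R) : dualPair θ p ∈ torsionPairsTwo S := by
  refine ⟨isTorsionPair_dualPair h h' hp.1, fun P hP => ?_⟩
  have : Module.Projective S P := hP
  exact ⟨fgDual θ' P, hp.2 _ (TwistedDual.injective_of_projective h' h (P := P)),
    ⟨bidualEquiv h' P⟩⟩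

lemma dualPair_mem_one (h : ∀ r, θ (θ' r).unop = MulOpposite.op r)
    (h' : ∀ s, θ' (θ s).unop = MulOpposite.op s)
    {p : ObjectProperty (FGModuleCat.{max uK w} R) × ObjectProperty (FGModuleCat.{max uK w} R)}
    (hp : p ∈ torsionPairsTwo R) : dualPair θ p ∈ torsionPairsOne S := by
  refine ⟨isTorsionPair_dualPair h h' hp.1, fun I hI => ?_⟩
  exact ⟨fgDual θ' I, hp.2 _ (TwistedDual.projective_of_injective h' h (I := I) hI),
    ⟨bidualEquiv h' I⟩⟩

end DualPair

/-! ### The translations as composites of duality and transpose -/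

section Translates

namespace TwistedDual

variable {K R S : Type*} [Field K] [Ring R] [Ring S] [Algebra K R] [Algebra K S]

/-- The dual of a product. -/
def prodEquiv (θ : S ≃ₐ[K] Rᵐᵒᵖ) (M N : Type*) [AddCommGroup M] [Module R M] [AddCommGroup N]
    [Module R N] : TwistedDual θ (M × N) ≃ₗ[S] TwistedDual θ M × TwistedDual θ N :=
  LinearEquiv.ofLinearMap ((map θ (LinearMap.inl R M N)).prod (map θ (LinearMap.inr R M N)))
    ((map θ (LinearMap.fst R M N)).coprod (map θ (LinearMap.snd R M N)))
    (LinearMap.ext fun ⟨f, g⟩ => Prod.ext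
      (ext fun m => by
        change f m + g 0 = f m
        rw [show g 0 = 0 from map_zero g.1, add_zero])
      (ext fun n => by
        change f 0 + g n = g n
        rw [show f 0 = 0 from map_zero f.1, zero_add]))
    (LinearMap.ext fun f => ext fun ⟨m, n⟩ => by
      change f (m, 0) + f (0, n) = f (m, n)
      rw [← TwistedDual.map_add', Prod.mk_add_mk, add_zero, zero_add])

variable (K) (A : Type*) [Ring A] [Algebra K A]

/-- The dual of a left module. -/
def equivDualOfLeft (M : Type*) [AddCommGroup M] [Module A M] :
    TwistedDual (AlgEquiv.refl : Aᵐᵒᵖ ≃ₐ[K] Aᵐᵒᵖ) M ≃ₗ[Aᵐᵒᵖ] DualOfLeft K A M where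
  toFun f := show RestrictScalars K A M →ₗ[K] K from
    { toFun := fun m => f (RestrictScalars.addEquiv K A M m)
      map_add' := fun _ _ => TwistedDual.map_add' f _ _
      map_smul' := fun k _ => f.2 k _ }
  invFun f :=
    let g : RestrictScalars K A M →ₗ[K] K := f
    ⟨g.toAddMonoidHom.comp (RestrictScalars.addEquiv K A M).symm.toAddMonoidHom,
      fun k m => g.map_smul k ((RestrictScalars.addEquiv K A M).symm m)⟩
  left_inv _ := rfl
  right_inv _ := rfl
  map_add' _ _ := rfl
  map_smul' _ _ := rfl

/-- The dual of a right module. -/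
def equivDualOfRight (N : Type*) [AddCommGroup N] [Module Aᵐᵒᵖ N] :
    TwistedDual (AlgEquiv.opOp K A) N ≃ₗ[A] DualOfRight K A N where
  toFun f := show RestrictScalars K Aᵐᵒᵖ N →ₗ[K] K from
    { toFun := fun m => f (RestrictScalars.addEquiv K Aᵐᵒᵖ N m)
      map_add' := fun _ _ => TwistedDual.map_add' f _ _
      map_smul' := fun k _ => f.2 k _ }
  invFun f :=
    let g : RestrictScalars K Aᵐᵒᵖ N →ₗ[K] K := f
    ⟨g.toAddMonoidHom.comp (RestrictScalars.addEquiv K Aᵐᵒᵖ N).symm.toAddMonoidHom,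
      fun k m => g.map_smul k ((RestrictScalars.addEquiv K Aᵐᵒᵖ N).symm m)⟩
  left_inv _ := rfl
  right_inv _ := rfl
  map_add' _ _ := rfl
  map_smul' _ _ := rfl

end TwistedDual

lemma IsMinimalPresentation.congr_right {R P₁ P₀ M N : Type*} [Ring R]
    [AddCommGroup P₁] [Module R P₁] [AddCommGroup P₀] [Module R P₀] [AddCommGroup M] [Module R M]
    [AddCommGroup N] [Module R N] {f : P₁ →ₗ[R] P₀} {g : P₀ →ₗ[R] M}
    (h : IsMinimalPresentation f g) (e : M ≃ₗ[R] N) :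
    IsMinimalPresentation f (e.toLinearMap ∘ₗ g) :=
  { h with
    surjective := e.surjective.comp h.surjective
    exact := fun x => by simpa using h.exact x
    superfluous_zero := by
      rw [LinearEquiv.ker_comp]
      exact h.superfluous_zero }

/-- Endomorphisms of the regular module on one side are multiplications on the other, determined by
the image of `1`. -/
lemma isDualizingBimodule_self (A : Type*) [Ring A] : IsDualizingBimodule A Aᵐᵒᵖ A where
  finite_left := inferInstance
  finite_right := Module.Finite.of_surjective
    (LinearMap.toSpanSingleton Aᵐᵒᵖ A 1) fun a => ⟨MulOpposite.op a, one_mul a⟩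
  projective_left := inferInstance
  projective_right := Module.Projective.of_equiv (M := Aᵐᵒᵖ)
    (LinearEquiv.ofBijective (LinearMap.toSpanSingleton Aᵐᵒᵖ A 1)
      ⟨fun a b h => by simpa using h, fun a => ⟨MulOpposite.op a, one_mul a⟩⟩)
  existsUnique_left φ := by
    refine ⟨φ 1, fun b => ?_, fun r hr => ?_⟩
    · have := φ.map_smul (MulOpposite.op b) 1
      simpa using this
    · simpa using (hr 1).symm
  existsUnique_right φ := by
    refine ⟨MulOpposite.op (φ 1), fun b => ?_, fun s hs => ?_⟩
    · have := φ.map_smul b 1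
      simpa using this
    · have := hs 1
      rw [this]
      simp

variable {K : Type uK} {A : Type (max uK w)} [Field K] [Ring A] [Algebra K A] [Module.Finite K A]

lemma isHereditaryDuality_self (K : Type uK) {A : Type (max uK w)} [Field K] [Ring A]
    [Algebra K A] [Module.Finite K A] (hA : IsFGHereditary A) :
    IsHereditaryDuality A Aᵐᵒᵖ A where
  bimodule := isDualizingBimodule_self A
  artinian_left := IsArtinianRing.of_finite K A
  artinian_right := IsArtinianRing.of_finite K Aᵐᵒᵖ
  hereditary_left := hA
  hereditary_right := TwistedDual.isFGHereditary.{uK, w} (K := K) (θ := AlgEquiv.refl)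
    (θ' := AlgEquiv.opOp K A) (fun _ => rfl) (fun _ => rfl) hA

lemma dualClass_sumSubcategory {R S : Type (max uK w)} [Ring R] [Ring S] [Algebra K R]
    [Algebra K S] [Module.Finite K R] [Module.Finite K S] {θ : S ≃ₐ[K] Rᵐᵒᵖ}
    (𝒞 𝒟 : ObjectProperty (FGModuleCat.{max uK w} R)) :
    dualClass θ (sumSubcategory 𝒞 𝒟) = sumSubcategory (dualClass θ 𝒞) (dualClass θ 𝒟) := by
  ext X
  constructor
  · rintro ⟨W, ⟨Y, Z, hY, hZ, ⟨e⟩⟩, ⟨e'⟩⟩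
    exact ⟨fgDual θ Y, fgDual θ Z, ⟨Y, hY, ⟨LinearEquiv.refl S _⟩⟩,
      ⟨Z, hZ, ⟨LinearEquiv.refl S _⟩⟩,
      ⟨e'.trans ((TwistedDual.mapEquiv θ e.symm).trans (TwistedDual.prodEquiv θ Y Z))⟩⟩
  · rintro ⟨Y', Z', ⟨Y, hY, ⟨e₁⟩⟩, ⟨Z, hZ, ⟨e₂⟩⟩, ⟨e⟩⟩
    exact ⟨FGModuleCat.of R (Y × Z), ⟨Y, Z, hY, hZ, ⟨LinearEquiv.refl R _⟩⟩,
      ⟨e.trans ((LinearEquiv.prodCongr e₁ e₂).trans (TwistedDual.prodEquiv θ Y Z).symm)⟩⟩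

lemma dualClass_projectiveModules {R S : Type (max uK w)} [Ring R] [Ring S] [Algebra K R]
    [Algebra K S] [Module.Finite K R] [Module.Finite K S] {θ : S ≃ₐ[K] Rᵐᵒᵖ} {θ' : R ≃ₐ[K] Sᵐᵒᵖ}
    (h : ∀ r, θ (θ' r).unop = MulOpposite.op r) (h' : ∀ s, θ' (θ s).unop = MulOpposite.op s) :
    dualClass θ (projectiveModules.{max uK w} R) = injectiveModules S := by
  ext X
  constructor
  · rintro ⟨P, hP, ⟨e⟩⟩
    have : Module.Projective R P := hP
    have : Module.Injective S (TwistedDual θ P) := TwistedDual.injective_of_projective h h'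
    exact Module.Baer.injective (Module.Baer.of_equiv e.symm (Module.Baer.of_injective this))
  · intro hX
    exact ⟨fgDual θ' X, TwistedDual.projective_of_injective h' h (I := X) hX, ⟨bidualEquiv h' X⟩⟩

lemma arTranslate_eq (hA : IsFGHereditary A) (𝒞 : ObjectProperty (FGModuleCat.{max uK w} A)) :
    arTranslate K 𝒞 = dualClass (AlgEquiv.opOp K A) (transposeClass Aᵐᵒᵖ A 𝒞) := by
  ext Y
  constructor
  · rintro ⟨X, hX, P₁, P₀, f, g, hf, ⟨e⟩⟩
    have := hf.projective_one
    have := (isHereditaryDuality_self K hA).finite_transposeOf f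
    exact ⟨FGModuleCat.of Aᵐᵒᵖ (TransposeOf Aᵐᵒᵖ A f),
      ⟨X, hX, P₁, P₀, f, g, hf, ⟨LinearEquiv.refl _ _⟩⟩,
      ⟨e.trans (TwistedDual.equivDualOfRight K A _).symm⟩⟩
  · rintro ⟨N, ⟨X, hX, P₁, P₀, f, g, hf, ⟨e⟩⟩, ⟨e'⟩⟩
    exact ⟨X, hX, P₁, P₀, f, g, hf,
      ⟨e'.trans ((TwistedDual.mapEquiv _ e.symm).trans (TwistedDual.equivDualOfRight K A _))⟩⟩

lemma inverseARTranslate_eq (𝒞 : ObjectProperty (FGModuleCat.{max uK w} A)) :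
    inverseARTranslate K 𝒞 =
      transposeClass A A (dualClass (AlgEquiv.refl : Aᵐᵒᵖ ≃ₐ[K] Aᵐᵒᵖ) 𝒞) := by
  ext Y
  constructor
  · rintro ⟨X, hX, P₁, P₀, f, g, hf, e⟩
    exact ⟨fgDual AlgEquiv.refl X, ⟨X, hX, ⟨LinearEquiv.refl _ _⟩⟩, P₁, P₀, f, _,
      hf.congr_right (TwistedDual.equivDualOfLeft K A X).symm, e⟩
  · rintro ⟨N, ⟨X, hX, ⟨e'⟩⟩, P₁, P₀, f, g, hf, e⟩
    exact ⟨X, hX, P₁, P₀, f, _,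
      hf.congr_right (e'.trans (TwistedDual.equivDualOfLeft K A X)), e⟩

lemma torsionSigma_eq (hA : IsFGHereditary A)
    (p : ObjectProperty (FGModuleCat.{max uK w} A) × ObjectProperty (FGModuleCat.{max uK w} A)) :
    torsionSigma K p = dualPair (AlgEquiv.opOp K A) (transposePair Aᵐᵒᵖ A p) := by
  refine Prod.ext ?_ (arTranslate_eq hA p.2)
  change sumSubcategory _ _ = dualClass _ (sumSubcategory _ _)
  rw [dualClass_sumSubcategory.{uK, w}, sumSubcategory_comm, arTranslate_eq hA,
    dualClass_projectiveModules.{uK, w} (θ' := AlgEquiv.refl) (fun _ => rfl) (fun _ => rfl)]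

lemma torsionSigmaInv_eq
    (p : ObjectProperty (FGModuleCat.{max uK w} A) × ObjectProperty (FGModuleCat.{max uK w} A)) :
    torsionSigmaInv K p =
      transposePair A A (dualPair (AlgEquiv.refl : Aᵐᵒᵖ ≃ₐ[K] Aᵐᵒᵖ) p) := by
  refine Prod.ext (inverseARTranslate_eq p.1) ?_
  change sumSubcategory _ _ = sumSubcategory _ _
  rw [inverseARTranslate_eq]
  rfl

/-- For a finite-dimensional hereditary algebra, translation defines mutually inverse bijections
between torsion pairs whose torsion class contains the injectives and torsion pairs whose
torsion-free class contains the projectives. -/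
theorem torsionSigma_bijOn (hA : IsFGHereditary A) :
    Set.BijOn (torsionSigmaInv K) (torsionPairsOne.{max uK w} A) (torsionPairsTwo A) ∧
      Set.BijOn (torsionSigma K) (torsionPairsTwo.{max uK w} A) (torsionPairsOne A) ∧
      Set.InvOn (torsionSigma K) (torsionSigmaInv K) (torsionPairsOne.{max uK w} A)
        (torsionPairsTwo A) := by
  have hD := isHereditaryDuality_self K hA
  have hθ (r : A) : (AlgEquiv.refl : Aᵐᵒᵖ ≃ₐ[K] Aᵐᵒᵖ) (AlgEquiv.opOp K A r).unop =
    MulOpposite.op r := rfl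
  have hθ' (s : Aᵐᵒᵖ) : AlgEquiv.opOp K A ((AlgEquiv.refl : Aᵐᵒᵖ ≃ₐ[K] Aᵐᵒᵖ) s).unop =
    MulOpposite.op s := rfl
  have hmaps : Set.MapsTo (torsionSigmaInv K) (torsionPairsOne.{max uK w} A)
      (torsionPairsTwo A) := fun p hp => by
    rw [torsionSigmaInv_eq.{uK, w}]
    exact hD.symm.transposePair_mem (dualPair_mem_two.{uK, w} hθ hθ' hp)
  have hmaps' : Set.MapsTo (torsionSigma K) (torsionPairsTwo.{max uK w} A)
      (torsionPairsOne A) := fun p hp => by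
    rw [torsionSigma_eq.{uK, w} hA]
    exact dualPair_mem_one.{uK, w} hθ' hθ (hD.transposePair_mem hp)
  have hinv : Set.InvOn (torsionSigma K) (torsionSigmaInv K) (torsionPairsOne.{max uK w} A)
      (torsionPairsTwo A) := by
    constructor
    -- Here `σ σ⁻ = D Tr Tr D`; the inner transposes cancel on `𝐅₂` over `Aᵐᵒᵖ`, then the dualities.
    · intro p hp
      rw [torsionSigmaInv_eq.{uK, w}, torsionSigma_eq.{uK, w} hA,
        hD.symm.transposePair_transposePair (dualPair_mem_two.{uK, w} hθ hθ' hp),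
        dualPair_dualPair.{uK, w} hθ hp.1]
    · intro p hp
      have hp' := hD.transposePair_mem hp
      rw [torsionSigma_eq.{uK, w} hA, torsionSigmaInv_eq.{uK, w},
        dualPair_dualPair.{uK, w} hθ' hp'.1, hD.transposePair_transposePair hp]
  exact ⟨hinv.bijOn hmaps hmaps', hinv.symm.bijOn hmaps' hmaps, hinv⟩

end Translates

end

theorem proposition5p3 (K : Type uK) [Field K] [IsAlgClosed K]
    (V : Type u) [Quiver.{v} V] [Fintype V] [∀ a b : V, Finite (a ⟶ b)]
    (hV : QuiverAcyclic V)
    (hPI : ∀ X : FGModuleCat.{max uK u v} (PathAlgebra K V),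
      projectiveModules (PathAlgebra K V) X → injectiveModules (PathAlgebra K V) X →
        Subsingleton X) :
    Set.BijOn (torsionSigmaInv K) (torsionPairsOne (PathAlgebra K V))
        (torsionPairsTwo (PathAlgebra K V)) ∧
      Set.BijOn (torsionSigma K) (torsionPairsTwo (PathAlgebra K V))
        (torsionPairsOne (PathAlgebra K V)) ∧
      Set.InvOn (torsionSigma K) (torsionSigmaInv K) (torsionPairsOne (PathAlgebra K V))
        (torsionPairsTwo (PathAlgebra K V)) :=
  have := PathAlgebra.finite K hV
  torsionSigma_bijOn.{uK, max u v} (PathAlgebra.isFGHereditary hV)
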